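/- Let $U\subseteq\mathbb R^2$ be open, let $\eta=(\eta^{ij})$ be a constant symmetric nondegenerate real $2\times 2$ matrix, let $g^{ij},\Gamma^{ij}_k,f^i$ ($i,j,k\in\{1,2\}$) be smooth functions on $U$ with $\det(g^{ij})\neq 0$ everywhere, and consider, on smooth fields $u=(u^1,u^2)(x)$ with values in compact subsets of $U$, the operators $$A^{ij}=\eta^{ij}\partial_x,\qquad B_0^{ij}=g^{ij}(u)\partial_x+\Gamma^{ij}_k(u)u^k_x,\qquad B^{ij}=B_0^{ij}+f^i(u)\,\partial_x^{-1}f^j(u),$$ where $\partial_x^{-1}h(x)=\tfrac12\big(\int_{-\infty}^x h\,dy-\int_x^{\infty}h\,dy\big)$. An operator $P$ is called Hamiltonian if $\{F,G\}_P=\int\frac{\delta F}{\delta u^i}P^{ij}\frac{\delta G}{\delta u^j}\,dx$ is skew-symmetric and satisfies the Jacobi identity on functionals of $u$ with smooth, compactly supported variational derivatives. Two Hamiltonian operators $P,Q$ are compatible (form a bi-Hamiltonian pair) if $P+\lambda Q$ is Hamiltonian for every $\lambda\in\mathbb R$. A vector field $f=f^i\partial_{u^i}$ is an infinitesimal isometry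 of a contravariant metric if the Lie derivative of the metric along $f$ vanishes. Then $A$ and $B$ form a bi-Hamiltonian pair if and only if 1. $A$ is compatible with $B_0$ (in particular $B_0$ is Hamiltonian), and 2. $f$ is an infinitesimal isometry of both $\eta^{ij}$ and $g^{ij}$. Moreover, if condition 2 holds, then $f$ is an infinitesimal isometry of $g^{ij}+\lambda\eta^{ij}$ for every $\lambda\in\mathbb R$. -/

import Mathlib

open scoped ContDiff Topology

noncomputable section

/-- A smooth finite-dimensional family `w p` (`p ∈ Ω`, `Ω` open in `ℝᵏ`) of fields
`x ↦ w p x ∈ U ⊆ ℝⁿ`: jointly smooth in `(p, x)`, and locally in `p` all values stay in one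
compact subset of `U`. -/
def IsSmoothFamily {n : ℕ} (U : Set (Fin n → ℝ)) {k : ℕ} (Ω : Set (Fin k → ℝ))
    (w : (Fin k → ℝ) → ℝ → Fin n → ℝ) : Prop :=
  IsOpen Ω ∧
  ContDiffOn ℝ ∞ (fun q : (Fin k → ℝ) × ℝ => w q.1 q.2) (Ω ×ˢ Set.univ) ∧
  ∀ p ∈ Ω, ∃ K : Set (Fin n → ℝ), IsCompact K ∧ K ⊆ U ∧ ∀ᶠ p' in 𝓝 p, ∀ x, w p' x ∈ K

/-- A single field: a smooth map `ℝ → U` with values in a compact subset of `U`. -/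
def IsFieldIn {n : ℕ} (U : Set (Fin n → ℝ)) (u : ℝ → Fin n → ℝ) : Prop :=
  ContDiff ℝ ∞ u ∧ ∃ K : Set (Fin n → ℝ), IsCompact K ∧ K ⊆ U ∧ ∀ x, u x ∈ K

/-- `dF` is the variational derivative `δF/δu` of the functional `F`: along every smooth family
of fields, `dF` is jointly smooth and (locally uniformly) compactly supported in `x`, and the
first variation of `F` is `∫ ∑ⱼ (δF/δuʲ) δuʲ dx`. Every local functional
`∫ h(x, u, uₓ, …) dx` with a smooth density of compact support in `x` has one,
namely its Euler-Lagrange expression. -/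
def IsVariationalDerivative {n : ℕ} (U : Set (Fin n → ℝ)) (F : (ℝ → Fin n → ℝ) → ℝ)
    (dF : (ℝ → Fin n → ℝ) → ℝ → Fin n → ℝ) : Prop :=
  ∀ (k : ℕ) (Ω : Set (Fin k → ℝ)) (w : (Fin k → ℝ) → ℝ → Fin n → ℝ),
    IsSmoothFamily U Ω w →
      ContDiffOn ℝ ∞ (fun q : (Fin k → ℝ) × ℝ => dF (w q.1) q.2) (Ω ×ˢ Set.univ) ∧
      (∀ p ∈ Ω, ∃ R : ℝ, ∀ᶠ p' in 𝓝 p, ∀ x : ℝ, R < |x| → dF (w p') x = 0) ∧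
      (∀ p ∈ Ω, ∀ e : Fin k → ℝ,
        HasDerivAt (fun s : ℝ => F (w (p + s • e)))
          (∫ x : ℝ, ∑ j, dF (w p) x j * deriv (fun s : ℝ => w (p + s • e) x j) 0) 0)

/-- A (possibly nonlocal) operator: to a field `u` and a covector `ψ = ψ(x)` it assigns the
vector `(P ψ)ⁱ(x) = Pⁱʲ ψⱼ (x)`. Sums and real multiples are taken pointwise. -/
abbrev FieldOperator (n : ℕ) : Type :=
  (ℝ → Fin n → ℝ) → (ℝ → Fin n → ℝ) → ℝ → Fin n → ℝ

/-- The skew-adjoint inverse of `d/dx`, with kernel `½ sgn(x - y)`, on integrable functions. -/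
def dxInv (h : ℝ → ℝ) (x : ℝ) : ℝ :=
  (1 / 2) * ((∫ y in Set.Iic x, h y) - ∫ y in Set.Ioi x, h y)

/-- The local first-order homogeneous operator `gⁱʲ(u) ∂ₓ + Γⁱʲₖ(u) uᵏₓ`. -/
def hydroOperator {n : ℕ} (g : (Fin n → ℝ) → Matrix (Fin n) (Fin n) ℝ)
    (Γ : (Fin n → ℝ) → Fin n → Fin n → Fin n → ℝ) : FieldOperator n :=
  fun u ψ x i =>
    ∑ j, (g (u x) i j * deriv (fun y => ψ y j) x
      + ∑ k, Γ (u x) i j k * deriv (fun y => u y k) x * ψ x j)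

/-- The nonlocal operator `fⁱ(u) ∂ₓ⁻¹ fʲ(u)`. -/
def tailOperator {n : ℕ} (f : (Fin n → ℝ) → Fin n → ℝ) : FieldOperator n :=
  fun u ψ x i => f (u x) i * dxInv (fun y => ∑ j, f (u y) j * ψ y j) x

/-- `{F, G}_P [u] = ∫ (δF/δuⁱ) Pⁱʲ (δG/δuʲ) dx`, in terms of the variational derivatives
`dF`, `dG` of `F`, `G`. -/
def poissonBracket {n : ℕ} (P : FieldOperator n) (dF dG : (ℝ → Fin n → ℝ) → ℝ → Fin n → ℝ)
    (u : ℝ → Fin n → ℝ) : ℝ :=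
  ∫ x : ℝ, ∑ i, dF u x i * P u (dG u) x i

/-- `P` is a Hamiltonian operator on fields with values in `U`: `{·,·}_P` is a Poisson bracket
on the functionals having a variational derivative, i.e. it is skew-symmetric and satisfies
`{{F,G},H} + {{G,H},F} + {{H,F},G} = 0`. Here `{K,H}`, for `K` a bracket, is the derivative of
`K` along the Hamiltonian vector field `P (δH/δu)`; that this derivative exists is required. -/
def IsHamiltonian {n : ℕ} (U : Set (Fin n → ℝ)) (P : FieldOperator n) : Prop :=
  (∀ (F G : (ℝ → Fin n → ℝ) → ℝ) (dF dG : (ℝ → Fin n → ℝ) → ℝ → Fin n → ℝ),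
    IsVariationalDerivative U F dF → IsVariationalDerivative U G dG →
    ∀ u, IsFieldIn U u → poissonBracket P dF dG u = -poissonBracket P dG dF u) ∧
  (∀ (F G H : (ℝ → Fin n → ℝ) → ℝ) (dF dG dH : (ℝ → Fin n → ℝ) → ℝ → Fin n → ℝ),
    IsVariationalDerivative U F dF → IsVariationalDerivative U G dG →
    IsVariationalDerivative U H dH →
    ∀ u, IsFieldIn U u → ∃ a b c : ℝ,
      HasDerivAt (fun s : ℝ => poissonBracket P dF dG (u + s • P u (dH u))) a 0 ∧
      HasDerivAt (fun s : ℝ => poissonBracket P dG dH (u + s • P u (dF u))) b 0 ∧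
      HasDerivAt (fun s : ℝ => poissonBracket P dH dF (u + s • P u (dG u))) c 0 ∧
      a + b + c = 0)

/-- Two Hamiltonian operators `P`, `Q` are compatible (form a bi-Hamiltonian pair) if
`P + c Q` is Hamiltonian for every real `c`. -/
def IsBiHamiltonianPair {n : ℕ} (U : Set (Fin n → ℝ)) (P Q : FieldOperator n) : Prop :=
  IsHamiltonian U P ∧ IsHamiltonian U Q ∧ ∀ c : ℝ, IsHamiltonian U (P + c • Q)

/-- Partial derivative `∂h/∂uᵏ`. -/
def partialDeriv {n : ℕ} (h : (Fin n → ℝ) → ℝ) (k : Fin n) (u : Fin n → ℝ) : ℝ :=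
  fderiv ℝ h u (Pi.single k 1)

/-- `f` is an infinitesimal isometry of the contravariant metric `gⁱʲ` on `U`: the Lie
derivative `fᵏ ∂ₖ gⁱʲ - gᵏʲ ∂ₖ fⁱ - gⁱᵏ ∂ₖ fʲ` vanishes. -/
def IsInfinitesimalIsometry {n : ℕ} (U : Set (Fin n → ℝ))
    (g : (Fin n → ℝ) → Matrix (Fin n) (Fin n) ℝ) (f : (Fin n → ℝ) → Fin n → ℝ) : Prop :=
  ∀ u ∈ U, ∀ i j, ∑ k, (f u k * partialDeriv (fun v => g v i j) k u
    - g u k j * partialDeriv (fun v => f v i) k u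
    - g u i k * partialDeriv (fun v => f v j) k u) = 0

end

/-! Write P_ε = g∂ + Γuₓ + ε f∂⁻¹f. Everything is done for this class with a free real ε, since it
contains A, B₀, B and all pencil members A + cB.

Reduction to pointwise conditions. The Poisson bracket axioms need only be tested on linear
functionals (`isHamiltonian_weaklyNonlocal_iff`): for general functionals the extra terms are second
variations, which cancel by their symmetry and by skewness of P_ε. The tail is automatically skew,
so skewness says exactly that the local part is skew; it implies that g is symmetric and ∂ₖgⁱʲ =
Γⁱʲₖ + Γʲⁱₖ (`IsSkewOn.skewRelations`).

The Jacobi sum is polynomial in ε. The ε² terms cancel cyclically (`jacobiTerm_cyclic_sum`). Modulo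
total derivatives (`mixedTerm_eq`), the ε term is the cyclic sum of ∂⁻¹(fχ)·(L_f B₀)(φ,ψ) +
(fχ)·T(φ,ψ), with Tⁱʲ = Γⁱʲₖfᵏ − gⁱᵏ∂ₖfʲ. The symmetrization of T is L_f g. Hence if f is an
isometry, T is skew and the cyclic sum of (fχ)T(φ,ψ) is the value of a 3-form, which is zero in
dimension two. So if f preserves both g and Γ, the Jacobi sum does not depend on ε.

Necessity. On a constant field, put φ, ψ near the origin and χ far away. Only the nonlocal term
survives, and it gives L_f g = 0 where f ≠ 0, then everywhere by continuity
(`lieMetric_eq_zero_of_jacobiAt_const`, `lieMetric_eq_zero_of_ne_zero`). Applied to B and to A + B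
this gives condition 2.

Equivalence. Once f is an isometry, the Jacobi identity on constant fields makes Γ torsion free
(`torsionFree_of_jacobiAt_const`). So Γ is the Levi-Civita symbol of g, and an isometry preserves it
(`lieSymbol_eq_zero`). Both Lie derivatives are linear in (g, Γ), so they vanish on the whole
pencil, degenerate members included, and the tail can be added or removed in every A + cB
(`isBiHamiltonianPair_congr`). -/

open MeasureTheory Set Filter

/-! ### Differentiation under the integral sign and symmetry of second derivatives. -/

section ParametricIntegrals

variable {E Z : Type*} [NormedAddCommGroup E] [NormedSpace ℝ E]
  [NormedAddCommGroup Z] [NormedSpace ℝ Z]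

/-- The integral of a jointly `C¹` function, supported in a fixed compact set, against a bounded
kernel can be differentiated under the integral sign. -/
theorem exists_hasFDerivAt_integral_mul [FiniteDimensional ℝ E]
    [MeasurableSpace Z] [BorelSpace Z] [SecondCountableTopology Z]
    {μ : Measure Z} [IsFiniteMeasureOnCompacts μ]
    {κ : Z → ℝ} (hκ : Measurable κ) {C : ℝ} (hC : ∀ z, |κ z| ≤ C)
    {Ω : Set E} (hΩ : IsOpen Ω) {h : E × Z → ℝ} (hh : ContDiffOn ℝ 1 h (Ω ×ˢ univ))
    {p : E} (hp : p ∈ Ω) {K : Set Z} (hK : IsCompact K)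
    (hs : ∀ᶠ p' in 𝓝 p, ∀ z, z ∉ K → h (p', z) = 0) :
    ∃ L : E →L[ℝ] ℝ, HasFDerivAt (fun p' => ∫ z, κ z * h (p', z) ∂μ) L p ∧
      ∀ e, L e = ∫ z, κ z * fderiv ℝ h (p, z) (e, 0) ∂μ := by
  have hΩZ : IsOpen (Ω ×ˢ (univ : Set Z)) := hΩ.prod isOpen_univ
  have hd : ∀ q ∈ Ω, ∀ z, HasFDerivAt (fun p' => h (p', z))
      ((fderiv ℝ h (q, z)).comp (ContinuousLinearMap.inl ℝ E Z)) q := by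
    intro q hq z
    have h1 : HasFDerivAt h (fderiv ℝ h (q, z)) (q, z) :=
      (((hh.contDiffAt (hΩZ.mem_nhds ⟨hq, mem_univ z⟩)).differentiableAt
        (by norm_num)).hasFDerivAt)
    exact h1.comp q (hasFDerivAt_prodMk_left q z)
  have hcf : ContinuousOn (fderiv ℝ h) (Ω ×ˢ univ) :=
    hh.continuousOn_fderiv_of_isOpen hΩZ le_rfl
  obtain ⟨r, hr, hrs⟩ : ∃ r > 0, ∀ q ∈ Metric.closedBall p r,
      q ∈ Ω ∧ ∀ z, z ∉ K → h (q, z) = 0 := by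
    have := (hΩ.eventually_mem hp).and hs
    rcases Metric.nhds_basis_closedBall.eventually_iff.1 this with ⟨r, hr, h⟩
    exact ⟨r, hr, fun q hq => h hq⟩
  -- Vanishing of h off K holds for all parameters near q, so the parameter derivative vanishes
  -- there too; with its bound M on the compact ball times K this makes C·M·1_K a dominating
  -- function.
  have hz0 : ∀ q ∈ Metric.ball p r, ∀ z, z ∉ K →
      (fderiv ℝ h (q, z)).comp (ContinuousLinearMap.inl ℝ E Z) = 0 := by
    intro q hq z hz
    refine (hd q (hrs q (Metric.ball_subset_closedBall hq)).1 z).unique ?_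
    refine (hasFDerivAt_const (0 : ℝ) q).congr_of_eventuallyEq ?_
    filter_upwards [Metric.isOpen_ball.mem_nhds hq] with q' hq'
    exact (hrs q' (Metric.ball_subset_closedBall hq')).2 z hz
  have hcomp : IsCompact (Metric.closedBall p r ×ˢ K) := (isCompact_closedBall p r).prod hK
  obtain ⟨M, hM⟩ := hcomp.exists_bound_of_continuousOn
    (f := fun q => (fderiv ℝ h q).comp (ContinuousLinearMap.inl ℝ E Z))
    ((hcf.mono (fun q hq => ⟨(hrs q.1 hq.1).1, mem_univ _⟩)).clm_comp continuousOn_const)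
  have hcont : ∀ q ∈ Ω, Continuous fun z => h (q, z) := fun q hq =>
    hh.continuousOn.comp_continuous (by fun_prop) fun z => ⟨hq, mem_univ _⟩
  have hC0 : 0 ≤ C := (abs_nonneg _).trans (hC 0)
  have hcontF : Continuous fun z => (fderiv ℝ h (p, z)).comp (ContinuousLinearMap.inl ℝ E Z) :=
    (hcf.comp_continuous (f := fun z => (p, z)) (by fun_prop)
      fun z => ⟨hp, mem_univ _⟩).clm_comp continuous_const
  have hbi : Integrable (K.indicator fun _ => C * M) μ :=
    (integrable_indicator_iff hK.measurableSet).2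
      (integrableOn_const hK.measure_lt_top.ne)
  have hmeas' : AEStronglyMeasurable (fun z => κ z • (fderiv ℝ h (p, z)).comp
      (ContinuousLinearMap.inl ℝ E Z)) μ :=
    hκ.aestronglyMeasurable.smul hcontF.aestronglyMeasurable
  have hbound : ∀ z, ∀ q ∈ Metric.ball p r, ‖κ z • (fderiv ℝ h (q, z)).comp
      (ContinuousLinearMap.inl ℝ E Z)‖ ≤ K.indicator (fun _ => C * M) z := by
    intro z q hq
    by_cases hz : z ∈ K
    · rw [indicator_of_mem hz, norm_smul]
      exact mul_le_mul (hC z) (hM (q, z) ⟨Metric.ball_subset_closedBall hq, hz⟩)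
        (norm_nonneg _) hC0
    · rw [hz0 q hq z hz, indicator_of_notMem hz]; simp
  have hint : Integrable (fun z => κ z • (fderiv ℝ h (p, z)).comp
      (ContinuousLinearMap.inl ℝ E Z)) μ :=
    hbi.mono' hmeas' (ae_of_all _ fun z => hbound z p (Metric.mem_ball_self hr))
  refine ⟨∫ z, κ z • (fderiv ℝ h (p, z)).comp (ContinuousLinearMap.inl ℝ E Z) ∂μ, ?_, ?_⟩
  · refine hasFDerivAt_integral_of_dominated_of_fderiv_le
      (F' := fun q z => κ z • (fderiv ℝ h (q, z)).comp (ContinuousLinearMap.inl ℝ E Z))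
      (bound := K.indicator fun _ => C * M)
      (Metric.ball_mem_nhds p hr) ?_ ?_ hmeas' ?_ hbi ?_
    · filter_upwards [hΩ.mem_nhds hp] with q hq
      exact hκ.aestronglyMeasurable.mul (hcont q hq).aestronglyMeasurable
    · refine (((hcont p hp).integrable_of_hasCompactSupport
        (HasCompactSupport.intro hK fun z hz =>
          (hrs p (Metric.mem_closedBall_self hr.le)).2 z hz))).bdd_mul
        hκ.aestronglyMeasurable (ae_of_all _ hC)
    · exact ae_of_all _ hbound
    · exact ae_of_all _ fun z q hq =>
        (hd q (hrs q (Metric.ball_subset_closedBall hq)).1 z).const_mul (κ z)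
  · intro e
    rw [ContinuousLinearMap.integral_apply hint]
    simp

/-- One-parameter version of `exists_hasFDerivAt_integral_mul`. -/
theorem hasDerivAt_integral_mul
    [MeasurableSpace Z] [BorelSpace Z] [SecondCountableTopology Z]
    {μ : Measure Z} [IsFiniteMeasureOnCompacts μ]
    {κ : Z → ℝ} (hκ : Measurable κ) {C : ℝ} (hC : ∀ z, |κ z| ≤ C)
    {I : Set ℝ} (hI : IsOpen I) {h : ℝ × Z → ℝ} (hh : ContDiffOn ℝ 1 h (I ×ˢ univ))
    {s : ℝ} (hsI : s ∈ I) {K : Set Z} (hK : IsCompact K)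
    (hs : ∀ᶠ t in 𝓝 s, ∀ z, z ∉ K → h (t, z) = 0) {h' : Z → ℝ}
    (hh' : ∀ z, HasDerivAt (fun t => h (t, z)) (h' z) s) :
    HasDerivAt (fun t => ∫ z, κ z * h (t, z) ∂μ) (∫ z, κ z * h' z ∂μ) s := by
  obtain ⟨L, hL, hLe⟩ := exists_hasFDerivAt_integral_mul (μ := μ) hκ hC hI hh hsI hK hs
  have h1 : L 1 = ∫ z, κ z * h' z ∂μ := by
    rw [hLe]
    refine integral_congr_ae (ae_of_all _ fun z => ?_)
    have hd : HasFDerivAt h (fderiv ℝ h (s, z)) (s, z) :=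
      ((hh.contDiffAt ((hI.prod isOpen_univ).mem_nhds ⟨hsI, mem_univ z⟩)).differentiableAt
        (by norm_num)).hasFDerivAt
    have := (hd.comp s (hasFDerivAt_prodMk_left s z)).hasDerivAt
    simp only [(hh' z).unique this]
    simp
  rw [← h1]
  exact hL.hasDerivAt

/-- A function whose directional derivatives are given by a linear form that is differentiable
at `p` is Fréchet differentiable near `p`, and the derivative of that form is symmetric. -/
theorem second_derivative_symmetric_of_lineDeriv {F : E → ℝ} {F' : E → E →L[ℝ] ℝ}
    {Ω : Set E} (hΩ : IsOpen Ω) (hF : ∀ p ∈ Ω, ∀ e, HasDerivAt (fun s : ℝ => F (p + s • e)) (F' p e) 0)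
    (hF' : ContinuousOn F' Ω) {p : E} (hp : p ∈ Ω) {F'' : E →L[ℝ] E →L[ℝ] ℝ}
    (hF'' : HasFDerivAt F' F'' p) (v w : E) : F'' v w = F'' w v := by
  refine second_derivative_symmetric_of_eventually (𝕜 := ℝ) (f := F) (f' := F') ?_ hF'' v w
  filter_upwards [hΩ.mem_nhds hp] with q hq
  rw [hasFDerivAt_iff_isLittleO_nhds_zero, Asymptotics.isLittleO_iff]
  intro c hc
  have hcont : ContinuousAt F' q := hF'.continuousAt (hΩ.mem_nhds hq)
  have hev : ∀ᶠ y in 𝓝 q, y ∈ Ω ∧ ‖F' y - F' q‖ ≤ c := by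
    refine (hΩ.eventually_mem hq).and ?_
    have : Tendsto (fun y => ‖F' y - F' q‖) (𝓝 q) (𝓝 ‖F' q - F' q‖) :=
      (hcont.sub continuousAt_const).norm
    rw [sub_self, norm_zero] at this
    exact this.eventually (ge_mem_nhds hc)
  obtain ⟨r, hr, hball⟩ := Metric.eventually_nhds_iff_ball.1 hev
  filter_upwards [Metric.ball_mem_nhds (0 : E) hr] with e he
  have hmem : ∀ t ∈ Icc (0 : ℝ) 1, q + t • e ∈ Metric.ball q r := by
    intro t ht
    rw [mem_ball_iff_norm, add_sub_cancel_left, norm_smul, Real.norm_of_nonneg ht.1]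
    rw [mem_ball_zero_iff] at he
    nlinarith [norm_nonneg e, ht.2]
  -- The mean value inequality is applied to F along the segment minus its linear part at q; the
  -- derivative of this difference is at most c‖e‖ because F' is continuous at q.
  have hder : ∀ t ∈ Icc (0 : ℝ) 1, HasDerivAt (fun s : ℝ => F (q + s • e) - F' q (s • e))
      (F' (q + t • e) e - F' q e) t := by
    intro t ht
    have h1 := hF (q + t • e) (hball _ (hmem t ht)).1 e
    have h2 : HasDerivAt (fun s : ℝ => F (q + s • e)) (F' (q + t • e) e) t := by
      have h3 : HasDerivAt (fun s : ℝ => s - t) 1 t := (hasDerivAt_id t).sub_const t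
      have h4 := HasDerivAt.comp t (h₂ := fun s : ℝ => F (q + t • e + s • e))
        (h := fun s : ℝ => s - t) (by simpa using h1) h3
      simp only [mul_one] at h4
      refine h4.congr_of_eventuallyEq (Eventually.of_forall fun s => ?_)
      simp only [Function.comp, add_assoc, ← add_smul]
      congr 3; ring
    have h5 : HasDerivAt (fun s : ℝ => F' q (s • e)) (F' q e) t := by
      simp only [map_smul, smul_eq_mul]
      simpa using (hasDerivAt_id t).mul_const (F' q e)
    exact h2.sub h5
  have hle := (convex_Icc (0 : ℝ) 1).norm_image_sub_le_of_norm_hasDerivWithin_le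
    (C := c * ‖e‖) (fun t ht => (hder t ht).hasDerivWithinAt) (fun t ht => by
      have := (hball _ (hmem t ht)).2
      rw [← sub_apply]
      exact (ContinuousLinearMap.le_opNorm _ _).trans
        (mul_le_mul_of_nonneg_right this (norm_nonneg _)))
    (left_mem_Icc.2 zero_le_one) (right_mem_Icc.2 zero_le_one)
  simp only [one_smul, zero_smul, add_zero, map_zero, sub_zero, norm_one, mul_one] at hle
  rw [sub_right_comm]
  exact hle

end ParametricIntegrals

/-! ### Test functions on the line. -/

section TestFunctions

/-- Smooth compactly supported functions on the line. -/
structure IsTest (a : ℝ → ℝ) : Prop where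
  smooth : ContDiff ℝ ∞ a
  compact : HasCompactSupport a

namespace IsTest

variable {a b : ℝ → ℝ}

theorem continuous (ha : IsTest a) : Continuous a := ha.smooth.continuous

theorem integrable (ha : IsTest a) : Integrable a :=
  ha.continuous.integrable_of_hasCompactSupport ha.compact

theorem mul_smooth (ha : IsTest a) (hb : ContDiff ℝ ∞ b) : IsTest fun x => a x * b x :=
  ⟨ha.smooth.mul hb, ha.compact.mul_right⟩

theorem smooth_mul (hb : ContDiff ℝ ∞ b) (ha : IsTest a) : IsTest fun x => b x * a x :=
  ⟨hb.mul ha.smooth, ha.compact.mul_left⟩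

theorem add (ha : IsTest a) (hb : IsTest b) : IsTest fun x => a x + b x :=
  ⟨ha.smooth.add hb.smooth, ha.compact.add hb.compact⟩

theorem neg (ha : IsTest a) : IsTest fun x => -a x :=
  ⟨ha.smooth.neg, ha.compact.comp_left neg_zero⟩

theorem sub (ha : IsTest a) (hb : IsTest b) : IsTest fun x => a x - b x := by
  simpa only [sub_eq_add_neg] using ha.add hb.neg

theorem zero : IsTest fun _ => (0 : ℝ) := ⟨contDiff_const, HasCompactSupport.zero⟩

theorem sum {ι : Type*} (s : Finset ι) {a : ι → ℝ → ℝ} (ha : ∀ i ∈ s, IsTest (a i)) :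
    IsTest fun x => ∑ i ∈ s, a i x := by
  classical
  induction s using Finset.induction_on with
  | empty => simpa using zero
  | insert i s hi ih =>
    simp only [Finset.sum_insert hi]
    exact (ha i (Finset.mem_insert_self i s)).add
      (ih fun j hj => ha j (Finset.mem_insert_of_mem hj))

theorem deriv (ha : IsTest a) : IsTest (deriv a) :=
  ⟨(contDiff_infty_iff_deriv.1 ha.smooth).2, ha.compact.deriv⟩

theorem hasDerivAt (ha : IsTest a) (x : ℝ) : HasDerivAt a (_root_.deriv a x) x :=
  ((contDiff_infty_iff_deriv.1 ha.smooth).1 x).hasDerivAt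

theorem integral_deriv (ha : IsTest a) : ∫ x, _root_.deriv a x = 0 :=
  integral_eq_zero_of_hasDerivAt_of_integrable ha.hasDerivAt ha.deriv.integrable ha.integrable

end IsTest

theorem hasCompactSupport_of_abs_lt {F : Type*} [Zero F] {a : ℝ → F} {R : ℝ}
    (h : ∀ x, R < |x| → a x = 0) : HasCompactSupport a := by
  refine HasCompactSupport.intro (isCompact_Icc (a := -R) (b := R)) fun x hx => h x ?_
  by_contra! hle
  exact hx (abs_le.1 hle)

theorem HasCompactSupport.exists_abs_lt {F : Type*} [Zero F] {a : ℝ → F}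
    (h : HasCompactSupport a) : ∃ R, ∀ x, R < |x| → a x = 0 := by
  obtain ⟨R, hR⟩ := h.isCompact.isBounded.subset_closedBall 0
  refine ⟨R, fun x hx => image_eq_zero_of_notMem_tsupport fun hmem => ?_⟩
  have := hR hmem
  rw [mem_closedBall_zero_iff, Real.norm_eq_abs] at this
  linarith

end TestFunctions

/-! ### The skew-adjoint inverse of d/dx as an integral operator. -/

section DxInv

/-- The kernel of `dxInv`. -/
noncomputable def halfSign (z : ℝ × ℝ) : ℝ := (1 / 2) * Real.sign (z.1 - z.2)

theorem measurable_halfSign : Measurable halfSign := by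
  have : Measurable Real.sign :=
    Measurable.ite measurableSet_Iio measurable_const
      (Measurable.ite measurableSet_Ioi measurable_const measurable_const)
  exact (this.comp (measurable_fst.sub measurable_snd)).const_mul _

theorem abs_halfSign_le (z : ℝ × ℝ) : |halfSign z| ≤ 1 / 2 := by
  unfold halfSign
  rcases Real.sign_apply_eq (z.1 - z.2) with h | h | h <;> rw [h] <;> norm_num [abs_le]

theorem halfSign_swap (z : ℝ × ℝ) : halfSign z.swap = -halfSign z := by
  simp only [halfSign, Prod.fst_swap, Prod.snd_swap]
  rw [← neg_sub z.1 z.2, Real.sign_neg]; ring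

/-- The kernel is zero on the diagonal, which is a null set. A bounded measurable kernel lets
Fubini's theorem and differentiation under the integral sign handle the nonlocal terms. -/
theorem dxInv_eq_integral_halfSign {h : ℝ → ℝ} (hh : Integrable h) (x : ℝ) :
    dxInv h x = ∫ y, halfSign (x, y) * h y := by
  have hint : Integrable fun y => halfSign (x, y) * h y :=
    hh.bdd_mul (measurable_halfSign.comp measurable_prodMk_left).aestronglyMeasurable
      (ae_of_all _ fun y => abs_halfSign_le (x, y))
  rw [← setIntegral_univ, ← Set.Iic_union_Ioi (a := x),
    setIntegral_union (Iic_disjoint_Ioi le_rfl) measurableSet_Ioi hint.integrableOn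
      hint.integrableOn, integral_Iic_eq_integral_Iio]
  have h1 : ∫ y in Iio x, halfSign (x, y) * h y = ∫ y in Iio x, (1 / 2) * h y := by
    refine setIntegral_congr_fun measurableSet_Iio fun y hy => ?_
    simp only [halfSign]
    rw [Real.sign_of_pos (sub_pos.2 hy), mul_one]
  have h2 : ∫ y in Ioi x, halfSign (x, y) * h y = ∫ y in Ioi x, (-(1 / 2)) * h y := by
    refine setIntegral_congr_fun measurableSet_Ioi fun y hy => ?_
    simp only [halfSign]
    rw [Real.sign_of_neg (sub_neg.2 hy)]; ring
  rw [h1, h2, integral_const_mul, integral_const_mul, dxInv, integral_Iic_eq_integral_Iio]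
  ring

theorem integral_mul_dxInv {a b : ℝ → ℝ} (ha : Integrable a) (hb : Integrable b) :
    ∫ x, a x * dxInv b x = ∫ z : ℝ × ℝ, halfSign z * (a z.1 * b z.2) := by
  rw [Measure.volume_eq_prod, integral_prod]
  · refine integral_congr_ae (ae_of_all _ fun x => ?_)
    simp only
    rw [dxInv_eq_integral_halfSign hb, ← integral_const_mul]
    exact integral_congr_ae (ae_of_all _ fun y => by simp only; ring)
  · exact (ha.mul_prod hb).bdd_mul measurable_halfSign.aestronglyMeasurable
      (ae_of_all _ abs_halfSign_le)

/-- The operator `dxInv` is skew-adjoint. -/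
theorem integral_mul_dxInv_swap {a b : ℝ → ℝ} (ha : Integrable a) (hb : Integrable b) :
    ∫ x, a x * dxInv b x = -∫ x, b x * dxInv a x := by
  rw [integral_mul_dxInv ha hb, integral_mul_dxInv hb ha, Measure.volume_eq_prod,
    ← integral_prod_swap, ← integral_neg]
  refine integral_congr_ae (ae_of_all _ fun z => ?_)
  simp only [halfSign_swap, Prod.fst_swap, Prod.snd_swap]
  ring

/-- The integrals over the two half-lines add up to the total integral, so `dxInv h` differs by a
constant from the primitive of h starting at 0. -/
theorem hasDerivAt_dxInv {h : ℝ → ℝ} (hi : Integrable h) (hc : Continuous h) (x : ℝ) :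
    HasDerivAt (dxInv h) (h x) x := by
  have hfun : dxInv h = fun x => (∫ y in (0 : ℝ)..x, h y) +
      ((∫ y in Iic 0, h y) - (1 / 2) * ∫ y, h y) := by
    funext x
    have h1 := intervalIntegral.integral_Iic_sub_Iic (a := 0) (b := x)
      hi.integrableOn hi.integrableOn
    have h2 : (∫ y in Iic x, h y) + ∫ y in Ioi x, h y = ∫ y, h y := by
      rw [← setIntegral_union (Iic_disjoint_Ioi le_rfl) measurableSet_Ioi hi.integrableOn
        hi.integrableOn, Iic_union_Ioi, setIntegral_univ]
    rw [dxInv, ← h1, ← h2]; ring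
  rw [hfun]
  exact (intervalIntegral.integral_hasDerivAt_right (hc.intervalIntegrable _ _)
    (hc.stronglyMeasurableAtFilter _ _) hc.continuousAt).add_const _

theorem IsTest.hasDerivAt_dxInv {h : ℝ → ℝ} (hh : IsTest h) (x : ℝ) :
    HasDerivAt (dxInv h) (h x) x :=
  _root_.hasDerivAt_dxInv hh.integrable hh.continuous x

theorem IsTest.contDiff_dxInv {h : ℝ → ℝ} (hh : IsTest h) : ContDiff ℝ ∞ (dxInv h) := by
  rw [contDiff_infty_iff_deriv]
  refine ⟨fun x => (hh.hasDerivAt_dxInv x).differentiableAt, ?_⟩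
  have : _root_.deriv (dxInv h) = h := funext fun x => (hh.hasDerivAt_dxInv x).deriv
  rw [this]; exact hh.smooth

/-- The constant is not sharp. The bound only serves to show that Hamiltonian vector fields, which
need not have compact support, are bounded. -/
theorem abs_dxInv_le {h : ℝ → ℝ} (hh : Integrable h) (x : ℝ) : |dxInv h x| ≤ ∫ y, |h y| := by
  rw [dxInv_eq_integral_halfSign hh]
  refine (norm_integral_le_integral_norm _).trans (integral_mono_of_nonneg
    (ae_of_all _ fun y => norm_nonneg (halfSign (x, y) * h y)) hh.abs (ae_of_all _ fun y => ?_))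
  simp only [norm_mul, Real.norm_eq_abs]
  have := abs_halfSign_le (x, y)
  nlinarith [abs_nonneg (h y)]

/-- To the left of the support of `h`, the function `dxInv h` is constant. -/
theorem dxInv_eq_of_forall_le {h : ℝ → ℝ} {x : ℝ} (hx : ∀ y ≤ x, h y = 0) :
    dxInv h x = -(1 / 2) * ∫ y, h y := by
  have h1 : ∫ y in Iic x, h y = 0 := by
    rw [setIntegral_congr_fun measurableSet_Iic (g := fun _ => (0 : ℝ)) fun y hy => hx y hy]
    simp
  have h2 : ∫ y in Ioi x, h y = ∫ y, h y := by
    refine setIntegral_eq_integral_of_forall_compl_eq_zero fun y hy => hx y ?_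
    simpa using hy
  rw [dxInv, h1, h2]; ring

end DxInv

/-! ### One-parameter families of functions on the line. -/

section Families

/-- The derivative at time `0` of a family of functions of `x`. -/
noncomputable def timeDeriv (a : ℝ × ℝ → ℝ) (x : ℝ) : ℝ := deriv (fun t => a (t, x)) 0

/-- The derivative with respect to `x` of a family of functions of `x`. -/
noncomputable def spaceDeriv (a : ℝ × ℝ → ℝ) (q : ℝ × ℝ) : ℝ := deriv (fun y => a (q.1, y)) q.2

variable {I : Set ℝ} {a b : ℝ × ℝ → ℝ}

theorem hasFDerivAt_of_smooth_family (hI : IsOpen I) (ha : ContDiffOn ℝ ∞ a (I ×ˢ univ)) {q : ℝ × ℝ}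
    (hq : q.1 ∈ I) : HasFDerivAt a (fderiv ℝ a q) q :=
  ((ha.contDiffAt ((hI.prod isOpen_univ).mem_nhds ⟨hq, mem_univ _⟩)).differentiableAt
    (by norm_num)).hasFDerivAt

theorem hasDerivAt_time (hI : IsOpen I) (ha : ContDiffOn ℝ ∞ a (I ×ˢ univ)) {q : ℝ × ℝ}
    (hq : q.1 ∈ I) : HasDerivAt (fun t => a (t, q.2)) (fderiv ℝ a q (1, 0)) q.1 := by
  have := ((hasFDerivAt_of_smooth_family hI ha hq).comp q.1
    (hasFDerivAt_prodMk_left q.1 q.2)).hasDerivAt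
  simpa [Function.comp_def] using this

theorem hasDerivAt_space (hI : IsOpen I) (ha : ContDiffOn ℝ ∞ a (I ×ˢ univ)) {q : ℝ × ℝ}
    (hq : q.1 ∈ I) : HasDerivAt (fun y => a (q.1, y)) (fderiv ℝ a q (0, 1)) q.2 := by
  have := ((hasFDerivAt_of_smooth_family hI ha hq).comp q.2
    (hasFDerivAt_prodMk_right q.1 q.2)).hasDerivAt
  simpa [Function.comp_def] using this

theorem timeDeriv_eq (hI : IsOpen I) (h0 : (0 : ℝ) ∈ I) (ha : ContDiffOn ℝ ∞ a (I ×ˢ univ)) (x : ℝ) :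
    timeDeriv a x = fderiv ℝ a (0, x) (1, 0) :=
  (hasDerivAt_time (q := (0, x)) hI ha h0).deriv

theorem hasDerivAt_timeDeriv (hI : IsOpen I) (h0 : (0 : ℝ) ∈ I) (ha : ContDiffOn ℝ ∞ a (I ×ˢ univ))
    (x : ℝ) : HasDerivAt (fun t => a (t, x)) (timeDeriv a x) 0 := by
  rw [timeDeriv_eq hI h0 ha]
  exact hasDerivAt_time (q := (0, x)) hI ha h0

theorem contDiffOn_fderiv_family (hI : IsOpen I) (ha : ContDiffOn ℝ ∞ a (I ×ˢ univ)) (e : ℝ × ℝ) :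
    ContDiffOn ℝ ∞ (fun q => fderiv ℝ a q e) (I ×ˢ univ) :=
  (ha.fderiv_of_isOpen (m := ∞) (hI.prod isOpen_univ) (by norm_num)).clm_apply contDiffOn_const

theorem contDiff_slice {n : ℕ∞ω} {t : ℝ} (ht : t ∈ I) (ha : ContDiffOn ℝ n a (I ×ˢ univ)) :
    ContDiff ℝ n fun x => a (t, x) :=
  contDiffOn_univ.1 (ha.comp (s := univ) (f := fun x : ℝ => (t, x)) (by fun_prop)
    fun x _ => ⟨ht, mem_univ _⟩)

theorem contDiff_timeDeriv (hI : IsOpen I) (h0 : (0 : ℝ) ∈ I) (ha : ContDiffOn ℝ ∞ a (I ×ˢ univ)) :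
    ContDiff ℝ ∞ (timeDeriv a) := by
  have : timeDeriv a = fun x => fderiv ℝ a (0, x) (1, 0) := funext (timeDeriv_eq hI h0 ha)
  rw [this]
  exact contDiff_slice h0 (contDiffOn_fderiv_family hI ha (1, 0))

theorem contDiffOn_spaceDeriv (hI : IsOpen I) (ha : ContDiffOn ℝ ∞ a (I ×ˢ univ)) :
    ContDiffOn ℝ ∞ (spaceDeriv a) (I ×ˢ univ) :=
  (contDiffOn_fderiv_family hI ha (0, 1)).congr fun _ hq => (hasDerivAt_space hI ha hq.1).deriv

/-- Derivatives in time and in space commute. -/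
theorem timeDeriv_spaceDeriv (hI : IsOpen I) (h0 : (0 : ℝ) ∈ I) (ha : ContDiffOn ℝ ∞ a (I ×ˢ univ))
    (x : ℝ) : timeDeriv (spaceDeriv a) x = deriv (timeDeriv a) x := by
  have hopen : IsOpen (I ×ˢ (univ : Set ℝ)) := hI.prod isOpen_univ
  have hmem : ((0 : ℝ), x) ∈ I ×ˢ (univ : Set ℝ) := ⟨h0, mem_univ _⟩
  have hfd : DifferentiableAt ℝ (fderiv ℝ a) (0, x) :=
    ((ha.fderiv_of_isOpen (m := ∞) hopen (by norm_num)).contDiffAt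
      (hopen.mem_nhds hmem)).differentiableAt (by norm_num)
  have hd : ∀ e : ℝ × ℝ, HasFDerivAt (fun q => fderiv ℝ a q e)
      ((fderiv ℝ (fderiv ℝ a) (0, x)).flip e) (0, x) := fun e => by
    simpa using hfd.hasFDerivAt.clm_apply (hasFDerivAt_const e ((0 : ℝ), x))
  have hsymm : IsSymmSndFDerivAt ℝ a (0, x) :=
    (ha.contDiffAt (hopen.mem_nhds hmem)).isSymmSndFDerivAt
      (by rw [minSmoothness_of_isRCLikeNormedField]; exact WithTop.coe_le_coe.2 (le_top : (2 : ℕ∞) ≤ ⊤))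
  have h1 : timeDeriv (spaceDeriv a) x = fderiv ℝ (fderiv ℝ a) (0, x) (1, 0) (0, 1) := by
    have h2 := ((hd (0, 1)).comp (0 : ℝ) (hasFDerivAt_prodMk_left (0 : ℝ) x)).hasDerivAt
    have h3 : (fun t : ℝ => spaceDeriv a (t, x)) =ᶠ[𝓝 0] fun t => fderiv ℝ a (t, x) (0, 1) := by
      filter_upwards [hI.mem_nhds h0] with t ht
      exact (hasDerivAt_space (q := (t, x)) hI ha ht).deriv
    rw [timeDeriv, h3.deriv_eq]
    refine h2.deriv.trans ?_
    simp
  have h4 : deriv (timeDeriv a) x = fderiv ℝ (fderiv ℝ a) (0, x) (0, 1) (1, 0) := by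
    have h2 := ((hd (1, 0)).comp x (hasFDerivAt_prodMk_right (0 : ℝ) x)).hasDerivAt
    have h3 : timeDeriv a = fun x => fderiv ℝ a (0, x) (1, 0) := funext (timeDeriv_eq hI h0 ha)
    rw [h3]
    refine h2.deriv.trans ?_
    simp
  rw [h1, h4, hsymm]

/-- A family is uniformly compactly supported near time `0`. -/
def HasUniformSupport (a : ℝ × ℝ → ℝ) : Prop :=
  ∃ R : ℝ, ∀ᶠ t in 𝓝 (0 : ℝ), ∀ x, R < |x| → a (t, x) = 0

theorem HasUniformSupport.isTest_slice (hs : HasUniformSupport a) (h0 : (0 : ℝ) ∈ I)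
    (ha : ContDiffOn ℝ ∞ a (I ×ˢ univ)) : IsTest fun x => a (0, x) := by
  obtain ⟨R, hR⟩ := hs
  exact ⟨contDiff_slice h0 ha, hasCompactSupport_of_abs_lt fun x hx => hR.self_of_nhds x hx⟩

theorem HasUniformSupport.isTest_timeDeriv (hs : HasUniformSupport a) (hI : IsOpen I)
    (h0 : (0 : ℝ) ∈ I) (ha : ContDiffOn ℝ ∞ a (I ×ˢ univ)) : IsTest (timeDeriv a) := by
  obtain ⟨R, hR⟩ := hs
  refine ⟨contDiff_timeDeriv hI h0 ha, hasCompactSupport_of_abs_lt (R := R) fun x hx => ?_⟩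
  have : (fun t => a (t, x)) =ᶠ[𝓝 0] fun _ => 0 := hR.mono fun t ht => ht x hx
  rw [timeDeriv, this.deriv_eq, deriv_const]

theorem HasUniformSupport.mul_right (hs : HasUniformSupport a) (b : ℝ × ℝ → ℝ) :
    HasUniformSupport fun q => a q * b q := by
  obtain ⟨R, hR⟩ := hs
  exact ⟨R, hR.mono fun t ht x hx => by simp [ht x hx]⟩

theorem HasUniformSupport.mul_left (b : ℝ × ℝ → ℝ) (hs : HasUniformSupport a) :
    HasUniformSupport fun q => b q * a q := by
  simpa only [mul_comm] using hs.mul_right b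

theorem HasUniformSupport.sum {ι : Type*} [Fintype ι] {a : ι → ℝ × ℝ → ℝ}
    (hs : ∀ i, HasUniformSupport (a i)) : HasUniformSupport fun q => ∑ i, a i q := by
  choose R hR using hs
  refine ⟨∑ i, |R i|, (eventually_all.2 hR).mono fun t ht x hx =>
    Finset.sum_eq_zero fun i _ => ht i x (lt_of_le_of_lt ?_ hx)⟩
  exact (le_abs_self _).trans
    (Finset.single_le_sum (f := fun i => |R i|) (fun j _ => abs_nonneg _) (Finset.mem_univ i))

theorem hasDerivAt_integral_family (hI : IsOpen I) (h0 : (0 : ℝ) ∈ I)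
    (ha : ContDiffOn ℝ ∞ a (I ×ˢ univ)) (hs : HasUniformSupport a) :
    HasDerivAt (fun t => ∫ x, a (t, x)) (∫ x, timeDeriv a x) 0 := by
  obtain ⟨R, hR⟩ := hs
  have := hasDerivAt_integral_mul (μ := (volume : Measure ℝ)) (κ := fun _ => 1) measurable_const
    (C := 1) (by simp) hI (ha.of_le (by norm_num)) h0 (isCompact_Icc (a := -R) (b := R))
    (hR.mono fun t ht x hx => ht x (by
      by_contra! hle
      exact hx (abs_le.1 hle)))
    (hasDerivAt_timeDeriv hI h0 ha)
  simpa using this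

/-- As a double integral against the kernel, the integrand a(t,x)b(t,y) is supported in a fixed
rectangle for t near 0, so no decay of `dxInv` is needed. -/
theorem hasDerivAt_integral_mul_dxInv (hI : IsOpen I) (h0 : (0 : ℝ) ∈ I)
    (ha : ContDiffOn ℝ ∞ a (I ×ˢ univ)) (hsa : HasUniformSupport a)
    (hb : ContDiffOn ℝ ∞ b (I ×ˢ univ)) (hsb : HasUniformSupport b) :
    HasDerivAt (fun t => ∫ x, a (t, x) * dxInv (fun y => b (t, y)) x)
      ((∫ x, timeDeriv a x * dxInv (fun y => b (0, y)) x) +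
        ∫ x, a (0, x) * dxInv (timeDeriv b) x) 0 := by
  have ha0 := hsa.isTest_slice h0 ha
  have hb0 := hsb.isTest_slice h0 hb
  have ha1 := hsa.isTest_timeDeriv hI h0 ha
  have hb1 := hsb.isTest_timeDeriv hI h0 hb
  obtain ⟨R, hR⟩ := hsa
  obtain ⟨S, hS⟩ := hsb
  have hab : ∀ {R : ℝ} {x : ℝ}, x ∉ Icc (-R) R → R < |x| := fun hx => by
    by_contra! hle
    exact hx (abs_le.1 hle)
  have key := hasDerivAt_integral_mul (μ := (volume : Measure (ℝ × ℝ))) measurable_halfSign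
    abs_halfSign_le hI (h := fun q : ℝ × (ℝ × ℝ) => a (q.1, q.2.1) * b (q.1, q.2.2)) (s := 0)
    (ContDiffOn.mul
      ((ha.of_le (by norm_num)).comp (t := I ×ˢ univ) (s := I ×ˢ univ)
        (f := fun q : ℝ × (ℝ × ℝ) => (q.1, q.2.1)) (by fun_prop) fun q hq => ⟨hq.1, mem_univ _⟩)
      ((hb.of_le (by norm_num)).comp (t := I ×ˢ univ) (s := I ×ˢ univ)
        (f := fun q : ℝ × (ℝ × ℝ) => (q.1, q.2.2)) (by fun_prop) fun q hq => ⟨hq.1, mem_univ _⟩))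
    h0 ((isCompact_Icc (a := -R) (b := R)).prod (isCompact_Icc (a := -S) (b := S)))
    ((hR.and hS).mono fun t ht z hz => by
      by_cases h1 : z.1 ∈ Icc (-R) R
      · have h2 : z.2 ∉ Icc (-S) S := fun h2 => hz ⟨h1, h2⟩
        simp only [ht.2 _ (hab h2), mul_zero]
      · simp only [ht.1 _ (hab h1), zero_mul])
    (fun z => (hasDerivAt_timeDeriv hI h0 ha z.1).mul (hasDerivAt_timeDeriv hI h0 hb z.2))
  have hint : ∀ {a b : ℝ → ℝ}, IsTest a → IsTest b →
      Integrable fun z : ℝ × ℝ => halfSign z * (a z.1 * b z.2) := fun ha hb =>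
    (ha.integrable.mul_prod hb.integrable).bdd_mul measurable_halfSign.aestronglyMeasurable
      (ae_of_all _ abs_halfSign_le)
  rw [integral_mul_dxInv ha1.integrable hb0.integrable,
    integral_mul_dxInv ha0.integrable hb1.integrable, ← integral_add (hint ha1 hb0) (hint ha0 hb1)]
  simp only [← mul_add]
  refine key.congr_of_eventuallyEq ?_
  filter_upwards [hI.mem_nhds h0, hR, hS] with t ht hRt hSt
  exact integral_mul_dxInv
    ((contDiff_slice ht ha).continuous.integrable_of_hasCompactSupport
      (hasCompactSupport_of_abs_lt hRt))
    ((contDiff_slice ht hb).continuous.integrable_of_hasCompactSupport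
      (hasCompactSupport_of_abs_lt hSt))

end Families

/-! ### Linearization of the operator and the product rule for its bilinear form. -/

section Linearization

variable {n : ℕ}

/-- Vector-valued test functions. -/
def IsTestVec (φ : ℝ → Fin n → ℝ) : Prop := ∀ i, IsTest fun x => φ x i

/-- The scalar function `∑ⱼ fʲ(u) ψⱼ`. -/
noncomputable def contract (f : (Fin n → ℝ) → Fin n → ℝ) (u ψ : ℝ → Fin n → ℝ) (x : ℝ) : ℝ :=
  ∑ j, f (u x) j * ψ x j

/-- The operator `gⁱʲ ∂ₓ + Γⁱʲₖ uᵏₓ + ε fⁱ ∂ₓ⁻¹ fʲ`. -/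
noncomputable def weaklyNonlocal (g : (Fin n → ℝ) → Matrix (Fin n) (Fin n) ℝ)
    (Γ : (Fin n → ℝ) → Fin n → Fin n → Fin n → ℝ) (f : (Fin n → ℝ) → Fin n → ℝ) (ε : ℝ) :
    FieldOperator n :=
  hydroOperator g Γ + ε • tailOperator f

/-- The bilinear form `∫ φᵢ Pⁱʲ ψⱼ dx` of an operator. -/
noncomputable def pairing (P : FieldOperator n) (u φ ψ : ℝ → Fin n → ℝ) : ℝ :=
  ∫ x, ∑ i, φ x i * P u ψ x i

/-- The linearization of `hydroOperator g Γ` in the field, in the direction `v`. -/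
noncomputable def hydroLinear (g : (Fin n → ℝ) → Matrix (Fin n) (Fin n) ℝ)
    (Γ : (Fin n → ℝ) → Fin n → Fin n → Fin n → ℝ) (u v ψ : ℝ → Fin n → ℝ) (x : ℝ) (i : Fin n) : ℝ :=
  ∑ j, (fderiv ℝ (fun w => g w i j) (u x) (v x) * deriv (fun y => ψ y j) x
    + ∑ k, (fderiv ℝ (fun w => Γ w i j k) (u x) (v x) * deriv (fun y => u y k) x
      + Γ (u x) i j k * deriv (fun y => v y k) x) * ψ x j)

/-- The linearization of `contract f` in the field, in the direction `v`. -/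
noncomputable def contractLinear (f : (Fin n → ℝ) → Fin n → ℝ) (u v ψ : ℝ → Fin n → ℝ) (x : ℝ) : ℝ :=
  ∑ j, fderiv ℝ (fun w => f w j) (u x) (v x) * ψ x j

/-- The linearization of `∫ φᵢ Pⁱʲ ψⱼ dx` in the field, for the operator `weaklyNonlocal`. -/
noncomputable def linearPairing (g : (Fin n → ℝ) → Matrix (Fin n) (Fin n) ℝ)
    (Γ : (Fin n → ℝ) → Fin n → Fin n → Fin n → ℝ) (f : (Fin n → ℝ) → Fin n → ℝ) (ε : ℝ)
    (u v φ ψ : ℝ → Fin n → ℝ) : ℝ :=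
  (∫ x, ∑ i, φ x i * hydroLinear g Γ u v ψ x i) +
    ε * ((∫ x, contractLinear f u v φ x * dxInv (contract f u ψ) x) +
      ∫ x, contract f u φ x * dxInv (contractLinear f u v ψ) x)

/-- Smoothness of the coefficients on an open set. -/
structure SmoothCoefficients (U : Set (Fin n → ℝ)) (g : (Fin n → ℝ) → Matrix (Fin n) (Fin n) ℝ)
    (Γ : (Fin n → ℝ) → Fin n → Fin n → Fin n → ℝ) (f : (Fin n → ℝ) → Fin n → ℝ) : Prop where
  isOpen : IsOpen U
  metric : ∀ i j, ContDiffOn ℝ ∞ (fun u => g u i j) U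
  symbol : ∀ i j k, ContDiffOn ℝ ∞ (fun u => Γ u i j k) U
  vector : ∀ i, ContDiffOn ℝ ∞ (fun u => f u i) U

/-- Smooth maps from the line to `U`. -/
structure IsSmoothIn (U : Set (Fin n → ℝ)) (u : ℝ → Fin n → ℝ) : Prop where
  smooth : ContDiff ℝ ∞ u
  mem : ∀ x, u x ∈ U

theorem IsFieldIn.isSmoothIn {U : Set (Fin n → ℝ)} {u : ℝ → Fin n → ℝ} (hu : IsFieldIn U u) :
    IsSmoothIn U u := by
  obtain ⟨h, K, -, hKU, hx⟩ := hu
  exact ⟨h, fun x => hKU (hx x)⟩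

variable {U : Set (Fin n → ℝ)} {g : (Fin n → ℝ) → Matrix (Fin n) (Fin n) ℝ}
    {Γ : (Fin n → ℝ) → Fin n → Fin n → Fin n → ℝ} {f : (Fin n → ℝ) → Fin n → ℝ} {ε : ℝ}
    {u v φ ψ : ℝ → Fin n → ℝ}

theorem IsSmoothIn.comp {h : (Fin n → ℝ) → ℝ} (hu : IsSmoothIn U u) (hh : ContDiffOn ℝ ∞ h U) :
    ContDiff ℝ ∞ fun x => h (u x) :=
  hh.comp_contDiff hu.smooth hu.mem

theorem contDiff_component {v : ℝ → Fin n → ℝ} (hv : ContDiff ℝ ∞ v) (k : Fin n) :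
    ContDiff ℝ ∞ fun x => v x k := contDiff_pi.1 hv k

theorem contDiff_deriv_component {v : ℝ → Fin n → ℝ} (hv : ContDiff ℝ ∞ v) (k : Fin n) :
    ContDiff ℝ ∞ (deriv fun x => v x k) :=
  (contDiff_infty_iff_deriv.1 (contDiff_component hv k)).2

theorem IsSmoothIn.fderiv_apply (hu : IsSmoothIn U u) (hU : IsOpen U) {h : (Fin n → ℝ) → ℝ}
    (hh : ContDiffOn ℝ ∞ h U) (hv : ContDiff ℝ ∞ v) :
    ContDiff ℝ ∞ fun x => fderiv ℝ h (u x) (v x) :=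
  ((hh.fderiv_of_isOpen (m := ∞) hU (by norm_num)).comp_contDiff hu.smooth hu.mem).clm_apply hv

theorem IsTestVec.contDiff (hφ : IsTestVec φ) : ContDiff ℝ ∞ φ :=
  contDiff_pi.2 fun i => (hφ i).smooth

theorem IsTestVec.contract (hφ : IsTestVec φ) (hc : SmoothCoefficients U g Γ f)
    (hu : IsSmoothIn U u) : IsTest (contract f u φ) :=
  IsTest.sum _ fun j _ => IsTest.smooth_mul (hu.comp (hc.vector j)) (hφ j)

theorem IsTestVec.contractLinear (hφ : IsTestVec φ) (hc : SmoothCoefficients U g Γ f)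
    (hu : IsSmoothIn U u) (hv : ContDiff ℝ ∞ v) : IsTest (contractLinear f u v φ) :=
  IsTest.sum _ fun j _ => IsTest.smooth_mul (hu.fderiv_apply hc.isOpen (hc.vector j) hv) (hφ j)

theorem IsTestVec.hydroOperator (hψ : IsTestVec ψ) (hc : SmoothCoefficients U g Γ f)
    (hu : IsSmoothIn U u) : IsTestVec (hydroOperator g Γ u ψ) := fun i =>
  IsTest.sum _ fun j _ => (IsTest.smooth_mul (hu.comp (hc.metric i j)) (hψ j).deriv).add
    (IsTest.sum _ fun k _ => IsTest.smooth_mul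
      ((hu.comp (hc.symbol i j k)).mul (contDiff_deriv_component hu.smooth k)) (hψ j))

theorem IsTestVec.hydroLinear (hψ : IsTestVec ψ) (hc : SmoothCoefficients U g Γ f)
    (hu : IsSmoothIn U u) (hv : ContDiff ℝ ∞ v) : IsTestVec (hydroLinear g Γ u v ψ) := fun i =>
  IsTest.sum _ fun j _ =>
    (IsTest.smooth_mul (hu.fderiv_apply hc.isOpen (hc.metric i j) hv) (hψ j).deriv).add
    (IsTest.sum _ fun k _ => IsTest.smooth_mul
      (((hu.fderiv_apply hc.isOpen (hc.symbol i j k) hv).mul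
          (contDiff_deriv_component hu.smooth k)).add
        ((hu.comp (hc.symbol i j k)).mul (contDiff_deriv_component hv k))) (hψ j))

theorem IsTestVec.dot (hφ : IsTestVec φ) (hψ : ContDiff ℝ ∞ ψ) :
    IsTest fun x => ∑ i, φ x i * ψ x i :=
  IsTest.sum _ fun i _ => (hφ i).mul_smooth (contDiff_component hψ i)

theorem IsTestVec.contDiff_tailOperator (hψ : IsTestVec ψ) (hc : SmoothCoefficients U g Γ f)
    (hu : IsSmoothIn U u) : ContDiff ℝ ∞ (tailOperator f u ψ) :=
  contDiff_pi.2 fun i => (hu.comp (hc.vector i)).mul (hψ.contract hc hu).contDiff_dxInv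

theorem IsTestVec.contDiff_weaklyNonlocal (hψ : IsTestVec ψ) (hc : SmoothCoefficients U g Γ f)
    (hu : IsSmoothIn U u) : ContDiff ℝ ∞ (weaklyNonlocal g Γ f ε u ψ) :=
  (hψ.hydroOperator hc hu).contDiff.add ((hψ.contDiff_tailOperator hc hu).const_smul ε)

theorem dxInv_add {a b : ℝ → ℝ} (ha : Integrable a) (hb : Integrable b) (x : ℝ) :
    dxInv (fun y => a y + b y) x = dxInv a x + dxInv b x := by
  rw [dxInv, integral_add ha.integrableOn hb.integrableOn,
    integral_add ha.integrableOn hb.integrableOn, dxInv, dxInv]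
  ring

/-- The bilinear form of `weaklyNonlocal`, split into its local and its nonlocal part. -/
theorem pairing_weaklyNonlocal (hc : SmoothCoefficients U g Γ f) (hu : IsSmoothIn U u)
    (hφ : IsTestVec φ) (hψ : IsTestVec ψ) :
    pairing (weaklyNonlocal g Γ f ε) u φ ψ = (∫ x, ∑ i, φ x i * hydroOperator g Γ u ψ x i) +
      ε * ∫ x, contract f u φ x * dxInv (contract f u ψ) x := by
  rw [← integral_const_mul, ← integral_add]
  · refine integral_congr_ae (ae_of_all _ fun x => ?_)
    simp only [weaklyNonlocal, Pi.add_apply, Pi.smul_apply, smul_eq_mul, mul_add,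
      Finset.sum_add_distrib, tailOperator]
    congr 1
    rw [contract, Finset.sum_mul, Finset.mul_sum]
    refine Finset.sum_congr rfl fun i _ => ?_
    change φ x i * (ε * (f (u x) i * dxInv (contract f u ψ) x)) = _
    ring
  · exact (hφ.dot (hψ.hydroOperator hc hu).contDiff).integrable
  · exact (((hφ.contract hc hu).mul_smooth (hψ.contract hc hu).contDiff_dxInv).integrable).const_mul ε

/-- The derivative at time `0` of a family of vector-valued functions. -/
noncomputable def vecTimeDeriv (w : ℝ × ℝ → Fin n → ℝ) (x : ℝ) (i : Fin n) : ℝ :=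
  timeDeriv (fun q => w q i) x

/-- Smooth families of vector-valued functions for times in `I`. -/
structure IsVecFamily (I : Set ℝ) (w : ℝ × ℝ → Fin n → ℝ) : Prop where
  isOpen : IsOpen I
  zero_mem : (0 : ℝ) ∈ I
  smooth : ContDiffOn ℝ ∞ w (I ×ˢ univ)

namespace IsVecFamily

variable {I : Set ℝ} {w χ : ℝ × ℝ → Fin n → ℝ}

theorem component (hw : IsVecFamily I w) (i : Fin n) :
    ContDiffOn ℝ ∞ (fun q => w q i) (I ×ˢ univ) := contDiffOn_pi.1 hw.smooth i

theorem comp (hw : IsVecFamily I w) {h : (Fin n → ℝ) → ℝ} (hh : ContDiffOn ℝ ∞ h U)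
    (hU : ∀ t ∈ I, ∀ x, w (t, x) ∈ U) : ContDiffOn ℝ ∞ (fun q => h (w q)) (I ×ˢ univ) :=
  hh.comp hw.smooth fun q hq => hU q.1 hq.1 q.2

theorem hasDerivAt (hw : IsVecFamily I w) (x : ℝ) :
    HasDerivAt (fun t => w (t, x)) (vecTimeDeriv w x) 0 :=
  hasDerivAt_pi.2 fun i => hasDerivAt_timeDeriv hw.isOpen hw.zero_mem (hw.component i) x

theorem hasDerivAt_comp (hw : IsVecFamily I w) {h : (Fin n → ℝ) → ℝ} (hUo : IsOpen U)
    (hh : ContDiffOn ℝ ∞ h U) (hU : ∀ t ∈ I, ∀ x, w (t, x) ∈ U) (x : ℝ) :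
    HasDerivAt (fun t => h (w (t, x))) (fderiv ℝ h (w (0, x)) (vecTimeDeriv w x)) 0 := by
  have h1 : HasFDerivAt h (fderiv ℝ h (w (0, x))) (w (0, x)) :=
    ((hh.contDiffAt (hUo.mem_nhds (hU 0 hw.zero_mem x))).differentiableAt (by norm_num)).hasFDerivAt
  exact h1.comp_hasDerivAt (0 : ℝ) (hw.hasDerivAt x)

theorem slice (hw : IsVecFamily I w) {t : ℝ} (ht : t ∈ I) : ContDiff ℝ ∞ fun x => w (t, x) :=
  contDiff_pi.2 fun i => contDiff_slice ht (hw.component i)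

theorem isSmoothIn (hw : IsVecFamily I w) (hU : ∀ t ∈ I, ∀ x, w (t, x) ∈ U) {t : ℝ} (ht : t ∈ I) :
    IsSmoothIn U fun x => w (t, x) := ⟨hw.slice ht, hU t ht⟩

theorem contDiff_vecTimeDeriv (hw : IsVecFamily I w) : ContDiff ℝ ∞ (vecTimeDeriv w) :=
  contDiff_pi.2 fun i => contDiff_timeDeriv hw.isOpen hw.zero_mem (hw.component i)

theorem hasDerivAt_spaceDeriv (hw : IsVecFamily I w) (i : Fin n) (x : ℝ) :
    HasDerivAt (fun t => deriv (fun y => w (t, y) i) x) (deriv (fun y => vecTimeDeriv w y i) x) 0 := by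
  have := hasDerivAt_timeDeriv hw.isOpen hw.zero_mem
    (contDiffOn_spaceDeriv hw.isOpen (hw.component i)) x
  rwa [timeDeriv_spaceDeriv hw.isOpen hw.zero_mem (hw.component i)] at this

end IsVecFamily

/-- Uniformly compactly supported families of vector-valued test functions. -/
structure IsTestFamily (I : Set ℝ) (φ : ℝ × ℝ → Fin n → ℝ) : Prop extends IsVecFamily I φ where
  support : ∃ R : ℝ, ∀ t ∈ I, ∀ x, R < |x| → φ (t, x) = 0

namespace IsTestFamily

variable {I : Set ℝ} {φ : ℝ × ℝ → Fin n → ℝ}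

theorem hasUniformSupport (hφ : IsTestFamily I φ) (i : Fin n) :
    HasUniformSupport fun q => φ q i := by
  obtain ⟨R, hR⟩ := hφ.support
  refine ⟨R, ?_⟩
  filter_upwards [hφ.isOpen.mem_nhds hφ.zero_mem] with t ht x hx
  rw [hR t ht x hx]; rfl

theorem isTestVec_slice (hφ : IsTestFamily I φ) {t : ℝ} (ht : t ∈ I) :
    IsTestVec fun x => φ (t, x) := fun i => by
  obtain ⟨R, hR⟩ := hφ.support
  exact ⟨contDiff_slice ht (hφ.component i),
    hasCompactSupport_of_abs_lt fun x hx => congrFun (hR t ht x hx) i⟩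

theorem isTestVec_vecTimeDeriv (hφ : IsTestFamily I φ) : IsTestVec (vecTimeDeriv φ) := fun i =>
  (hφ.hasUniformSupport i).isTest_timeDeriv hφ.isOpen hφ.zero_mem (hφ.component i)

end IsTestFamily

variable {I : Set ℝ} {w : ℝ × ℝ → Fin n → ℝ} {Φ Ψ : ℝ × ℝ → Fin n → ℝ}

/-- Time enters in four places: through each of the two test families, and through the field in each
of the two factors fⁱ and fʲ. -/
theorem hasDerivAt_integral_contract_mul_dxInv (hc : SmoothCoefficients U g Γ f)
    (hw : IsVecFamily I w) (hU : ∀ t ∈ I, ∀ x, w (t, x) ∈ U) (hΦ : IsTestFamily I Φ)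
    (hΨ : IsTestFamily I Ψ) :
    HasDerivAt (fun t => ∫ x, contract f (fun y => w (t, y)) (fun y => Φ (t, y)) x *
        dxInv (contract f (fun y => w (t, y)) (fun y => Ψ (t, y))) x)
      ((∫ x, contract f (fun y => w (0, y)) (vecTimeDeriv Φ) x *
          dxInv (contract f (fun y => w (0, y)) (fun y => Ψ (0, y))) x) +
        (∫ x, contract f (fun y => w (0, y)) (fun y => Φ (0, y)) x *
          dxInv (contract f (fun y => w (0, y)) (vecTimeDeriv Ψ)) x) +
        ((∫ x, contractLinear f (fun y => w (0, y)) (vecTimeDeriv w) (fun y => Φ (0, y)) x *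
          dxInv (contract f (fun y => w (0, y)) (fun y => Ψ (0, y))) x) +
        (∫ x, contract f (fun y => w (0, y)) (fun y => Φ (0, y)) x *
          dxInv (contractLinear f (fun y => w (0, y)) (vecTimeDeriv w) (fun y => Ψ (0, y))) x))) 0 := by
  have hu := hw.isSmoothIn hU hw.zero_mem
  have hfam : ∀ {Φ : ℝ × ℝ → Fin n → ℝ}, IsTestFamily I Φ →
      ContDiffOn ℝ ∞ (fun q => ∑ j, f (w q) j * Φ q j) (I ×ˢ univ) ∧
      HasUniformSupport (fun q => ∑ j, f (w q) j * Φ q j) ∧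
      timeDeriv (fun q => ∑ j, f (w q) j * Φ q j) =
        fun x => contract f (fun y => w (0, y)) (vecTimeDeriv Φ) x +
          contractLinear f (fun y => w (0, y)) (vecTimeDeriv w) (fun y => Φ (0, y)) x := by
    intro Φ hΦ
    refine ⟨ContDiffOn.sum fun j _ => (hw.comp (hc.vector j) hU).mul (hΦ.component j),
      HasUniformSupport.sum fun j => (hΦ.hasUniformSupport j).mul_left _, funext fun x => ?_⟩
    refine (HasDerivAt.fun_sum fun j _ => (hw.hasDerivAt_comp hc.isOpen (hc.vector j) hU x).mul
      (hasDerivAt_timeDeriv hΦ.isOpen hΦ.zero_mem (hΦ.component j) x)).deriv.trans ?_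
    simp only [contract, contractLinear, ← Finset.sum_add_distrib]
    exact Finset.sum_congr rfl fun j _ => by rw [vecTimeDeriv]; ring
  obtain ⟨hΦ1, hΦ2, hΦ3⟩ := hfam hΦ
  obtain ⟨hΨ1, hΨ2, hΨ3⟩ := hfam hΨ
  have key := hasDerivAt_integral_mul_dxInv hw.isOpen hw.zero_mem hΦ1 hΦ2 hΨ1 hΨ2
  have hv := hw.contDiff_vecTimeDeriv
  have tΦ := hΦ.isTestVec_slice hw.zero_mem
  have tΨ := hΨ.isTestVec_slice hw.zero_mem
  have tΦ' := hΦ.isTestVec_vecTimeDeriv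
  have tΨ' := hΨ.isTestVec_vecTimeDeriv
  refine key.congr_deriv ?_
  change (∫ x, timeDeriv _ x * dxInv (contract f _ fun y => Ψ (0, y)) x) +
    ∫ x, contract f (fun y => w (0, y)) (fun y => Φ (0, y)) x * dxInv (timeDeriv _) x = _
  rw [hΦ3, hΨ3]
  simp only [dxInv_add (tΨ'.contract hc hu).integrable (tΨ.contractLinear hc hu hv).integrable,
    add_mul, mul_add]
  rw [integral_add, integral_add]
  · ring
  · exact ((tΦ.contract hc hu).mul_smooth (tΨ'.contract hc hu).contDiff_dxInv).integrable
  · exact ((tΦ.contract hc hu).mul_smooth (tΨ.contractLinear hc hu hv).contDiff_dxInv).integrable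
  · exact ((tΦ'.contract hc hu).mul_smooth (tΨ.contract hc hu).contDiff_dxInv).integrable
  · exact ((tΦ.contractLinear hc hu hv).mul_smooth (tΨ.contract hc hu).contDiff_dxInv).integrable

/-- Product rule under the integral; time and space derivatives of the field and of the test family
are interchanged. -/
theorem hasDerivAt_integral_mul_hydroOperator (hc : SmoothCoefficients U g Γ f)
    (hw : IsVecFamily I w) (hU : ∀ t ∈ I, ∀ x, w (t, x) ∈ U) (hΦ : IsTestFamily I Φ)
    (hΨ : IsTestFamily I Ψ) :
    HasDerivAt (fun t => ∫ x, ∑ i, Φ (t, x) i *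
        hydroOperator g Γ (fun y => w (t, y)) (fun y => Ψ (t, y)) x i)
      ((∫ x, ∑ i, vecTimeDeriv Φ x i *
          hydroOperator g Γ (fun y => w (0, y)) (fun y => Ψ (0, y)) x i) +
        (∫ x, ∑ i, Φ (0, x) i * hydroOperator g Γ (fun y => w (0, y)) (vecTimeDeriv Ψ) x i) +
        ∫ x, ∑ i, Φ (0, x) i *
          hydroLinear g Γ (fun y => w (0, y)) (vecTimeDeriv w) (fun y => Ψ (0, y)) x i) 0 := by
  have hu := hw.isSmoothIn hU hw.zero_mem
  have hv := hw.contDiff_vecTimeDeriv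
  have tΦ := hΦ.isTestVec_slice hw.zero_mem
  have tΨ := hΨ.isTestVec_slice hw.zero_mem
  have tΦ' := hΦ.isTestVec_vecTimeDeriv
  have tΨ' := hΨ.isTestVec_vecTimeDeriv
  have h1 : ContDiffOn ℝ ∞ (fun q : ℝ × ℝ => ∑ i, Φ q i * ∑ j, (g (w q) i j *
      spaceDeriv (fun q => Ψ q j) q + ∑ k, Γ (w q) i j k * spaceDeriv (fun q => w q k) q * Ψ q j))
      (I ×ˢ univ) :=
    ContDiffOn.sum fun i _ => (hΦ.component i).mul <| ContDiffOn.sum fun j _ =>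
      ((hw.comp (hc.metric i j) hU).mul (contDiffOn_spaceDeriv hw.isOpen (hΨ.component j))).add <|
      ContDiffOn.sum fun k _ => ((hw.comp (hc.symbol i j k) hU).mul
        (contDiffOn_spaceDeriv hw.isOpen (hw.component k))).mul (hΨ.component j)
  have h2 : HasUniformSupport (fun q : ℝ × ℝ => ∑ i, Φ q i * ∑ j, (g (w q) i j *
      spaceDeriv (fun q => Ψ q j) q + ∑ k, Γ (w q) i j k * spaceDeriv (fun q => w q k) q * Ψ q j)) :=
    HasUniformSupport.sum fun i => (hΦ.hasUniformSupport i).mul_right _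
  have i1 := (tΦ'.dot (tΨ.hydroOperator hc hu).contDiff)
  have i2 := (tΦ.dot (tΨ'.hydroOperator hc hu).contDiff)
  have i3 := (tΦ.dot (tΨ.hydroLinear hc hu hv).contDiff)
  refine (hasDerivAt_integral_family hw.isOpen hw.zero_mem h1 h2).congr_deriv ?_
  rw [← integral_add i1.integrable i2.integrable,
    ← integral_add (i1.add i2).integrable i3.integrable]
  · refine integral_congr_ae (ae_of_all _ fun x => ?_)
    refine (HasDerivAt.fun_sum fun i _ =>
      (hasDerivAt_timeDeriv hΦ.isOpen hΦ.zero_mem (hΦ.component i) x).fun_mul <|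
      HasDerivAt.fun_sum fun j _ => ((hw.hasDerivAt_comp hc.isOpen (hc.metric i j) hU x).fun_mul
        (hΨ.hasDerivAt_spaceDeriv j x)).fun_add <| HasDerivAt.fun_sum fun k _ =>
          ((hw.hasDerivAt_comp hc.isOpen (hc.symbol i j k) hU x).fun_mul
        (hw.hasDerivAt_spaceDeriv k x)).fun_mul
      (hasDerivAt_timeDeriv hΨ.isOpen hΨ.zero_mem (hΨ.component j) x)).deriv.trans ?_
    simp only [hydroOperator, hydroLinear, ← Finset.sum_add_distrib]
    refine Finset.sum_congr rfl fun i _ => ?_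
    rw [add_assoc]
    congr 1
    rw [← mul_add, ← Finset.sum_add_distrib]
    congr 1
    refine Finset.sum_congr rfl fun j _ => ?_
    simp only [vecTimeDeriv, add_mul, Finset.sum_add_distrib]
    ring

/-- The product rule for `∫ φᵢ Pⁱʲ ψⱼ dx` along a family of fields and of test functions. -/
theorem hasDerivAt_pairing (hc : SmoothCoefficients U g Γ f)
    (hw : IsVecFamily I w) (hU : ∀ t ∈ I, ∀ x, w (t, x) ∈ U) (hΦ : IsTestFamily I Φ)
    (hΨ : IsTestFamily I Ψ) :
    HasDerivAt (fun t => pairing (weaklyNonlocal g Γ f ε) (fun y => w (t, y)) (fun y => Φ (t, y))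
        (fun y => Ψ (t, y)))
      (pairing (weaklyNonlocal g Γ f ε) (fun y => w (0, y)) (vecTimeDeriv Φ) (fun y => Ψ (0, y)) +
        pairing (weaklyNonlocal g Γ f ε) (fun y => w (0, y)) (fun y => Φ (0, y)) (vecTimeDeriv Ψ) +
        linearPairing g Γ f ε (fun y => w (0, y)) (vecTimeDeriv w) (fun y => Φ (0, y))
          (fun y => Ψ (0, y))) 0 := by
  have hu := hw.isSmoothIn hU hw.zero_mem
  have tΦ := hΦ.isTestVec_slice hw.zero_mem
  have tΨ := hΨ.isTestVec_slice hw.zero_mem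
  have h := (hasDerivAt_integral_mul_hydroOperator hc hw hU hΦ hΨ).add
    ((hasDerivAt_integral_contract_mul_dxInv hc hw hU hΦ hΨ).const_mul ε)
  rw [pairing_weaklyNonlocal hc hu hΦ.isTestVec_vecTimeDeriv tΨ,
    pairing_weaklyNonlocal hc hu tΦ hΨ.isTestVec_vecTimeDeriv, linearPairing]
  refine (h.congr_deriv (by ring)).congr_of_eventuallyEq ?_
  filter_upwards [hw.isOpen.mem_nhds hw.zero_mem] with t ht
  exact pairing_weaklyNonlocal hc (hw.isSmoothIn hU ht) (hΦ.isTestVec_slice ht)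
    (hΨ.isTestVec_slice ht)

end Linearization

/-! ### Variations of fields and symmetry of the second variation. -/

section Variations

variable {n : ℕ} {U : Set (Fin n → ℝ)} {u V W : ℝ → Fin n → ℝ}

/-- Smooth bounded vector fields along a field. -/
structure IsBoundedSmooth (V : ℝ → Fin n → ℝ) : Prop where
  smooth : ContDiff ℝ ∞ V
  bounded : ∃ C, ∀ x, ‖V x‖ ≤ C

theorem IsTestVec.isBoundedSmooth {φ : ℝ → Fin n → ℝ} (hφ : IsTestVec φ) : IsBoundedSmooth φ := by
  refine ⟨hφ.contDiff, ?_⟩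
  have : ∀ i, ∃ C, ∀ x, ‖φ x i‖ ≤ C := fun i =>
    (hφ i).compact.exists_bound_of_continuous (hφ i).continuous
  choose C hC using this
  refine ⟨∑ i, |C i|, fun x => (pi_norm_le_iff_of_nonneg
    (Finset.sum_nonneg fun i _ => abs_nonneg _)).2 fun i => ?_⟩
  exact (hC i x).trans ((le_abs_self _).trans
    (Finset.single_le_sum (f := fun i => |C i|) (fun j _ => abs_nonneg _) (Finset.mem_univ i)))

theorem IsBoundedSmooth.add (hV : IsBoundedSmooth V) (hW : IsBoundedSmooth W) :
    IsBoundedSmooth (V + W) := by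
  obtain ⟨hV, C, hC⟩ := hV
  obtain ⟨hW, D, hD⟩ := hW
  exact ⟨hV.add hW, C + D, fun x => (norm_add_le _ _).trans (add_le_add (hC x) (hD x))⟩

/-- The two-parameter variation `u + p₀ V + p₁ W` of a field. -/
def variation (u V W : ℝ → Fin n → ℝ) (p : Fin 2 → ℝ) (x : ℝ) : Fin n → ℝ :=
  u x + p 0 • V x + p 1 • W x

/-- Boundedness of V and W replaces compact support: small multiples keep all values in a closed
thickening of K that is still inside U. -/
theorem exists_isSmoothFamily_variation (hU : IsOpen U) (hu : IsFieldIn U u)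
    (hV : IsBoundedSmooth V) (hW : IsBoundedSmooth W) :
    ∃ r > 0, IsSmoothFamily U (Metric.ball 0 r) (variation u V W) := by
  obtain ⟨hus, K, hK, hKU, huK⟩ := hu
  obtain ⟨hVs, C, hC⟩ := hV
  obtain ⟨hWs, D, hD⟩ := hW
  obtain ⟨δ, hδ, hδU⟩ := hK.exists_cthickening_subset_open hU hKU
  have hC0 : 0 ≤ C := (norm_nonneg _).trans (hC 0)
  have hD0 : 0 ≤ D := (norm_nonneg _).trans (hD 0)
  have hCD : 0 < C + D + 1 := by linarith
  -- In the sup norm the displacement is at most ‖p‖(C + D); the added 1 keeps the denominator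
  -- positive.
  refine ⟨δ / (C + D + 1), div_pos hδ hCD, Metric.isOpen_ball, ?_, ?_⟩
  · have h : ContDiff ℝ ∞ fun q : (Fin 2 → ℝ) × ℝ => variation u V W q.1 q.2 := by
      unfold variation; fun_prop
    exact h.contDiffOn
  · intro p hp
    refine ⟨Metric.cthickening δ K, hK.cthickening, hδU, ?_⟩
    filter_upwards [Metric.isOpen_ball.mem_nhds hp] with q hq x
    rw [mem_ball_zero_iff, lt_div_iff₀ hCD] at hq
    refine Metric.mem_cthickening_of_dist_le _ (u x) δ K (huK x) ?_
    rw [dist_eq_norm, variation, add_assoc, add_sub_cancel_left]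
    refine (norm_add_le _ _).trans ?_
    rw [norm_smul, norm_smul]
    have h0 : ‖q 0‖ ≤ ‖q‖ := norm_le_pi_norm q 0
    have h1 : ‖q 1‖ ≤ ‖q‖ := norm_le_pi_norm q 1
    have h2 := mul_le_mul h0 (hC x) (norm_nonneg _) (norm_nonneg _)
    have h3 := mul_le_mul h1 (hD x) (norm_nonneg _) (norm_nonneg _)
    nlinarith [norm_nonneg q]

theorem variation_single_zero (t : ℝ) :
    variation u V W (Pi.single 0 t) = fun x => u x + t • V x := by
  funext x; simp [variation]

theorem variation_single_one (t : ℝ) :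
    variation u V W (Pi.single 1 t) = fun x => u x + t • W x := by
  funext x; simp [variation]

/-- The values of a variational derivative along a line of fields. -/
def alongLine (dF : (ℝ → Fin n → ℝ) → ℝ → Fin n → ℝ) (u V : ℝ → Fin n → ℝ) (q : ℝ × ℝ) : Fin n → ℝ :=
  dF (fun x => u x + q.1 • V x) q.2

/-- Stated for all small r, so that several functionals can share one time interval. -/
theorem eventually_isTestFamily_alongLine (hU : IsOpen U) {F : (ℝ → Fin n → ℝ) → ℝ}
    {dF : (ℝ → Fin n → ℝ) → ℝ → Fin n → ℝ} (hF : IsVariationalDerivative U F dF)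
    (hu : IsFieldIn U u) (hV : IsBoundedSmooth V) :
    ∀ᶠ r in 𝓝[>] (0 : ℝ), IsTestFamily (Ioo (-r) r) (alongLine dF u V) := by
  -- The second direction is a dummy: only the first parameter is moved below.
  obtain ⟨ρ, hρ, hfam⟩ := exists_isSmoothFamily_variation hU hu hV hV
  obtain ⟨h1, h2, -⟩ := hF 2 _ _ hfam
  obtain ⟨R, hR⟩ := h2 0 (Metric.mem_ball_self hρ)
  obtain ⟨σ, hσ, hσR⟩ := Metric.eventually_nhds_iff_ball.1 hR
  have hnorm : ∀ t : ℝ, ‖(Pi.single 0 t : Fin 2 → ℝ)‖ = |t| := fun t => by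
    rw [Pi.norm_single]; rfl
  filter_upwards [Ioo_mem_nhdsGT (lt_min hρ hσ)] with r hr
  have hlt : ∀ t ∈ Ioo (-r) r, |t| < ρ ∧ |t| < σ := fun t ht => by
    have h := abs_lt.2 ht
    exact ⟨h.trans (hr.2.trans_le (min_le_left _ _)), h.trans (hr.2.trans_le (min_le_right _ _))⟩
  refine ⟨⟨isOpen_Ioo, ⟨by linarith [hr.1], hr.1⟩, ?_⟩, R, fun t ht x hx => ?_⟩
  · have h3 := h1.comp (s := Ioo (-r) r ×ˢ (univ : Set ℝ))
      (f := fun q : ℝ × ℝ => ((Pi.single 0 q.1 : Fin 2 → ℝ), q.2))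
      (ContDiff.contDiffOn (ContDiff.prodMk
        ((contDiff_pi.2 fun i => by
          rcases eq_or_ne i 0 with rfl | hi
          · simpa using contDiff_fst
          · simpa [Pi.single_eq_of_ne hi] using contDiff_const)) contDiff_snd))
      (fun q hq => ⟨by rw [mem_ball_zero_iff, hnorm]; exact (hlt q.1 hq.1).1, mem_univ _⟩)
    refine h3.congr fun q _ => ?_
    simp only [Function.comp, variation_single_zero, alongLine]
  · have := hσR (Pi.single 0 t) (by rw [mem_ball_zero_iff, hnorm]; exact (hlt t ht).2) x hx
    rwa [variation_single_zero] at this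

/-- The second variation of a functional is symmetric. -/
theorem integral_second_variation_symmetric (hU : IsOpen U) {F : (ℝ → Fin n → ℝ) → ℝ}
    {dF : (ℝ → Fin n → ℝ) → ℝ → Fin n → ℝ} (hF : IsVariationalDerivative U F dF)
    (hu : IsFieldIn U u) (hV : IsBoundedSmooth V) (hW : IsBoundedSmooth W) :
    ∫ x, ∑ j, vecTimeDeriv (alongLine dF u V) x j * W x j =
      ∫ x, ∑ j, vecTimeDeriv (alongLine dF u W) x j * V x j := by
  obtain ⟨ρ, hρ, hfam⟩ := exists_isSmoothFamily_variation hU hu hV hW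
  obtain ⟨h1, h2, h3⟩ := hF 2 _ _ hfam
  set Ω : Set (Fin 2 → ℝ) := Metric.ball 0 ρ with hΩ
  have hΩo : IsOpen Ω := Metric.isOpen_ball
  have h0 : (0 : Fin 2 → ℝ) ∈ Ω := Metric.mem_ball_self hρ
  set w := variation u V W with hw
  have hsm : ∀ {X : ℝ → Fin n → ℝ}, ContDiff ℝ ∞ X → ContDiffOn ℝ ∞
      (fun q : (Fin 2 → ℝ) × ℝ => ∑ j, dF (w q.1) q.2 j * X q.2 j) (Ω ×ˢ univ) := fun hX =>
    ContDiffOn.sum fun j _ => (contDiffOn_pi.1 h1 j).mul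
      ((contDiff_component hX j).comp contDiff_snd).contDiffOn
  have hder : ∀ {X : ℝ → Fin n → ℝ}, ContDiff ℝ ∞ X → ∀ p ∈ Ω, ∃ L : (Fin 2 → ℝ) →L[ℝ] ℝ,
      HasFDerivAt (fun p => ∫ x, ∑ j, dF (w p) x j * X x j) L p ∧
      ∀ e, L e = ∫ x, fderiv ℝ (fun q : (Fin 2 → ℝ) × ℝ => ∑ j, dF (w q.1) q.2 j * X q.2 j)
        (p, x) (e, 0) := by
    intro X hX p hp
    obtain ⟨R, hR⟩ := h2 p hp
    have := exists_hasFDerivAt_integral_mul (μ := (volume : Measure ℝ)) (κ := fun _ => 1)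
      measurable_const (C := 1) (by simp) hΩo ((hsm hX).of_le (by norm_num)) hp
      (isCompact_Icc (a := -R) (b := R)) (hR.mono fun t ht x hx => Finset.sum_eq_zero fun j _ => by
        have : R < |x| := by
          by_contra! hle
          exact hx (abs_le.1 hle)
        simp [ht x this])
    simpa using this
  obtain ⟨π, hπ⟩ : ∃ π : Fin 2 → ((Fin 2 → ℝ) →L[ℝ] ℝ), ∀ k e, π k e = e k :=
    ⟨fun k => ContinuousLinearMap.proj k, fun _ _ => rfl⟩
  -- The first variation is linear in the parameter direction, with coefficients ∫ δF/δu·V and ∫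
  -- δF/δu·W; these are the partial derivatives of F on the two-parameter family.
  have hline : ∀ p ∈ Ω, ∀ e : Fin 2 → ℝ, HasDerivAt (fun s : ℝ => F (w (p + s • e)))
      (((∫ x, ∑ j, dF (w p) x j * V x j) • π 0 +
        (∫ x, ∑ j, dF (w p) x j * W x j) • π 1) e) 0 := by
    intro p hp e
    refine (h3 p hp e).congr_deriv ?_
    have hd : ∀ x j, deriv (fun s : ℝ => w (p + s • e) x j) 0 = e 0 * V x j + e 1 * W x j := by
      intro x j
      have : HasDerivAt (fun s : ℝ => u x j + (p 0 + s * e 0) * V x j + (p 1 + s * e 1) * W x j)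
          (e 0 * V x j + e 1 * W x j) 0 := by
        have h : ∀ a b c : ℝ, HasDerivAt (fun s : ℝ => (a + s * b) * c) (b * c) 0 := fun a b c => by
          simpa using (((hasDerivAt_id (0 : ℝ)).mul_const b).const_add a).mul_const c
        exact ((h _ _ _).const_add _).add (h _ _ _)
      rw [← this.deriv]
      rfl
    simp only [hd, mul_add, Finset.sum_add_distrib]
    obtain ⟨R, hR⟩ := h2 p hp
    have hR := hR.self_of_nhds
    have htest : ∀ {X : ℝ → Fin n → ℝ}, ContDiff ℝ ∞ X →
        Integrable fun x => ∑ j, dF (w p) x j * X x j := fun {X} hX => by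
      refine Continuous.integrable_of_hasCompactSupport ?_ (hasCompactSupport_of_abs_lt (R := R)
        fun x hx => Finset.sum_eq_zero fun j _ => by rw [hR x hx]; simp)
      exact (hsm hX).continuousOn.comp_continuous (f := fun x : ℝ => (p, x)) (by fun_prop)
        fun x => ⟨hp, mem_univ _⟩
    have hrw : ∀ (c : ℝ) (X : ℝ → Fin n → ℝ) (x : ℝ), ∑ j, dF (w p) x j * (c * X x j) =
        c * ∑ j, dF (w p) x j * X x j := fun c X x => by
      rw [Finset.mul_sum]; exact Finset.sum_congr rfl fun j _ => by ring
    simp only [hrw]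
    rw [integral_add ((htest hV.smooth).const_mul _) ((htest hW.smooth).const_mul _),
      integral_const_mul, integral_const_mul]
    simp [hπ, mul_comm]
  obtain ⟨LV, hLV, hLV'⟩ := hder hV.smooth 0 h0
  obtain ⟨LW, hLW, hLW'⟩ := hder hW.smooth 0 h0
  have hsymm := second_derivative_symmetric_of_lineDeriv (F := fun p => F (w p)) hΩo hline
    (fun p hp => by
      obtain ⟨A, hA, -⟩ := hder hV.smooth p hp
      obtain ⟨B, hB, -⟩ := hder hW.smooth p hp
      exact ((hA.continuousAt.smul continuousAt_const).add
        (hB.continuousAt.smul continuousAt_const)).continuousWithinAt) h0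
    ((hLV.smul_const (π 0)).add (hLW.smul_const (π 1))) (Pi.single 0 1) (Pi.single 1 1)
  -- Identifies each mixed second derivative with the derivative of δF/δu along one of the two
  -- directions, paired with the other.
  have heval : ∀ {X Y : ℝ → Fin n → ℝ} (k : Fin 2), ContDiff ℝ ∞ X → IsBoundedSmooth Y →
      (∀ t : ℝ, w (Pi.single k t) = fun x => u x + t • Y x) → ∀ x : ℝ,
      fderiv ℝ (fun q : (Fin 2 → ℝ) × ℝ => ∑ j, dF (w q.1) q.2 j * X q.2 j)
        (0, x) (Pi.single k 1, 0) = ∑ j, vecTimeDeriv (alongLine dF u Y) x j * X x j := by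
    intro X Y k hX hY hwY x
    obtain ⟨r, hr⟩ := (eventually_isTestFamily_alongLine hU hF hu hY).exists
    have hfd : HasFDerivAt (fun q : (Fin 2 → ℝ) × ℝ => ∑ j, dF (w q.1) q.2 j * X q.2 j)
        (fderiv ℝ (fun q : (Fin 2 → ℝ) × ℝ => ∑ j, dF (w q.1) q.2 j * X q.2 j) (0, x)) (0, x) :=
      (((hsm hX).contDiffAt ((hΩo.prod isOpen_univ).mem_nhds ⟨h0, mem_univ x⟩)).differentiableAt
        (by norm_num)).hasFDerivAt
    have hc : HasDerivAt (fun t : ℝ => ((t • Pi.single k 1 : Fin 2 → ℝ), x))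
        ((Pi.single k 1 : Fin 2 → ℝ), (0 : ℝ)) 0 := by
      have := (hasDerivAt_id (0 : ℝ)).smul_const (Pi.single k 1 : Fin 2 → ℝ)
      simpa using this.prodMk (hasDerivAt_const (0 : ℝ) x)
    have h4 := HasFDerivAt.comp_hasDerivAt_of_eq (0 : ℝ) hfd hc (by simp)
    refine h4.unique ?_
    refine (HasDerivAt.fun_sum fun j _ => (hasDerivAt_timeDeriv hr.isOpen hr.zero_mem
      (hr.component j) x).mul_const (X x j)).congr_of_eventuallyEq ?_
    refine Eventually.of_forall fun t => ?_
    have : (t • Pi.single k 1 : Fin 2 → ℝ) = Pi.single k t := by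
      rw [← Pi.single_smul]; simp
    simp only [Function.comp, this, hwY, alongLine]
  simp only [add_apply, ContinuousLinearMap.smulRight_apply,
    smul_apply, hπ, smul_eq_mul] at hsymm
  simp only [Pi.single_eq_same, ne_eq, zero_ne_one, one_ne_zero, not_false_eq_true,
    Pi.single_eq_of_ne, mul_zero, mul_one, zero_add, add_zero] at hsymm
  rw [hLV', hLW'] at hsymm
  simp only [heval 1 hV.smooth hW variation_single_one,
    heval 0 hW.smooth hV variation_single_zero] at hsymm
  exact hsymm

/-- Linear functionals have a (constant) variational derivative. -/
theorem isVariationalDerivative_linear {ρ : ℝ → Fin n → ℝ} (hρ : IsTestVec ρ) :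
    IsVariationalDerivative U (fun u => ∫ x, ∑ j, ρ x j * u x j) (fun _ => ρ) := by
  intro k Ω w hw
  obtain ⟨hΩ, hsm, -⟩ := hw
  refine ⟨(hρ.contDiff.comp contDiff_snd).contDiffOn, fun p hp => ?_, fun p hp e => ?_⟩
  · choose R hR using fun i => (hρ i).compact.exists_abs_lt
    refine ⟨∑ i, |R i|, Eventually.of_forall fun _ x hx => funext fun i => hR i x ?_⟩
    exact ((le_abs_self _).trans (Finset.single_le_sum (f := fun i => |R i|)
      (fun j _ => abs_nonneg _) (Finset.mem_univ i))).trans_lt hx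
  · set I : Set ℝ := (fun s : ℝ => p + s • e) ⁻¹' Ω with hI
    have hIo : IsOpen I := hΩ.preimage (by fun_prop)
    have h0 : (0 : ℝ) ∈ I := by simpa [hI] using hp
    have hcomp : ∀ j, ContDiffOn ℝ ∞ (fun q : ℝ × ℝ => w (p + q.1 • e) q.2 j) (I ×ˢ univ) :=
      fun j => (contDiffOn_pi.1 hsm j).comp (f := fun q : ℝ × ℝ => (p + q.1 • e, q.2))
        (ContDiff.contDiffOn (by fun_prop)) fun q hq => ⟨hq.1, mem_univ _⟩
    have h1 : ContDiffOn ℝ ∞ (fun q : ℝ × ℝ => ∑ j, ρ q.2 j * w (p + q.1 • e) q.2 j)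
        (I ×ˢ univ) := ContDiffOn.sum fun j _ =>
      ((hρ j).smooth.comp contDiff_snd).contDiffOn.mul (hcomp j)
    have h2 : HasUniformSupport (fun q : ℝ × ℝ => ∑ j, ρ q.2 j * w (p + q.1 • e) q.2 j) :=
      HasUniformSupport.sum fun j => HasUniformSupport.mul_right (a := fun q => ρ q.2 j) (by
        obtain ⟨R, hR⟩ := (hρ j).compact.exists_abs_lt
        exact ⟨R, Eventually.of_forall fun _ x hx => hR x hx⟩) _
    refine (hasDerivAt_integral_family hIo h0 h1 h2).congr_deriv ?_
    refine integral_congr_ae (ae_of_all _ fun x => ?_)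
    exact (HasDerivAt.fun_sum fun j _ =>
      (hasDerivAt_timeDeriv hIo h0 (hcomp j) x).const_mul (ρ x j)).deriv

end Variations

/-! ### Reduction of the Hamiltonian property to test covectors. -/

section HamiltonianCriterion

variable {n : ℕ} {U : Set (Fin n → ℝ)} {g : (Fin n → ℝ) → Matrix (Fin n) (Fin n) ℝ}
    {Γ : (Fin n → ℝ) → Fin n → Fin n → Fin n → ℝ} {f : (Fin n → ℝ) → Fin n → ℝ} {ε : ℝ}
    {u φ ψ χ : ℝ → Fin n → ℝ}

/-- The local part has compact support. The tail is bounded because f is bounded on the compact set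
of values of u and ∂⁻¹ of an integrable function is bounded. -/
theorem IsTestVec.isBoundedSmooth_weaklyNonlocal (hψ : IsTestVec ψ)
    (hc : SmoothCoefficients U g Γ f) (hu : IsFieldIn U u) :
    IsBoundedSmooth (weaklyNonlocal g Γ f ε u ψ) := by
  have hu' := hu.isSmoothIn
  refine (hψ.hydroOperator hc hu').isBoundedSmooth.add
    ⟨(hψ.contDiff_tailOperator hc hu').const_smul ε, ?_⟩
  obtain ⟨-, K, hK, hKU, huK⟩ := hu
  obtain ⟨C, hC⟩ := hK.exists_bound_of_continuousOn
    ((contDiffOn_pi.2 hc.vector).continuousOn.mono hKU)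
  refine ⟨|ε| * (C * ∫ y, |_root_.contract f u ψ y|), fun x => ?_⟩
  have h : (ε • tailOperator f) u ψ x = ε • (dxInv (_root_.contract f u ψ) x • f (u x)) := by
    funext i
    simp only [Pi.smul_apply, smul_eq_mul, tailOperator]
    rw [mul_comm (f (u x) i)]; rfl
  rw [h, norm_smul, norm_smul, mul_comm C, Real.norm_eq_abs, Real.norm_eq_abs]
  exact mul_le_mul_of_nonneg_left (mul_le_mul (abs_dxInv_le (hψ.contract hc hu').integrable x)
    (hC _ (huK x)) (norm_nonneg _) (integral_nonneg fun y => abs_nonneg _)) (abs_nonneg ε)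

/-- Skew-symmetry of an operator on test functions. -/
def IsSkewOn (U : Set (Fin n → ℝ)) (P : FieldOperator n) : Prop :=
  ∀ u φ ψ, IsFieldIn U u → IsTestVec φ → IsTestVec ψ → pairing P u φ ψ = -pairing P u ψ φ

/-- The derivative of `∫ φᵢ Pⁱʲ ψⱼ dx` along `P χ`, for `P = weaklyNonlocal g Γ f ε`. -/
noncomputable def jacobiTerm (g : (Fin n → ℝ) → Matrix (Fin n) (Fin n) ℝ)
    (Γ : (Fin n → ℝ) → Fin n → Fin n → Fin n → ℝ) (f : (Fin n → ℝ) → Fin n → ℝ) (ε : ℝ)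
    (u φ ψ χ : ℝ → Fin n → ℝ) : ℝ :=
  linearPairing g Γ f ε u (weaklyNonlocal g Γ f ε u χ) φ ψ

/-- The Jacobi identity of `weaklyNonlocal g Γ f ε` on test functions. -/
def JacobiAt (g : (Fin n → ℝ) → Matrix (Fin n) (Fin n) ℝ)
    (Γ : (Fin n → ℝ) → Fin n → Fin n → Fin n → ℝ) (f : (Fin n → ℝ) → Fin n → ℝ) (ε : ℝ)
    (u : ℝ → Fin n → ℝ) : Prop :=
  ∀ φ ψ χ, IsTestVec φ → IsTestVec ψ → IsTestVec χ →
    jacobiTerm g Γ f ε u φ ψ χ + jacobiTerm g Γ f ε u ψ χ φ + jacobiTerm g Γ f ε u χ φ ψ = 0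

theorem IsVariationalDerivative.isTestVec (hU : IsOpen U) {F : (ℝ → Fin n → ℝ) → ℝ}
    {dF : (ℝ → Fin n → ℝ) → ℝ → Fin n → ℝ} (hF : IsVariationalDerivative U F dF)
    (hu : IsFieldIn U u) : IsTestVec (dF u) := by
  obtain ⟨r, hr⟩ := (eventually_isTestFamily_alongLine hU hF hu
    (V := 0) ⟨contDiff_const, 0, by simp⟩).exists
  have := hr.isTestVec_slice hr.zero_mem
  simpa [alongLine] using this

/-- The derivative of a Poisson bracket along a bounded vector field. -/
theorem hasDerivAt_poissonBracket (hc : SmoothCoefficients U g Γ f)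
    {F G : (ℝ → Fin n → ℝ) → ℝ} {dF dG : (ℝ → Fin n → ℝ) → ℝ → Fin n → ℝ}
    (hF : IsVariationalDerivative U F dF) (hG : IsVariationalDerivative U G dG)
    (hu : IsFieldIn U u) {V : ℝ → Fin n → ℝ} (hV : IsBoundedSmooth V) :
    HasDerivAt (fun s : ℝ => poissonBracket (weaklyNonlocal g Γ f ε) dF dG (u + s • V))
      (pairing (weaklyNonlocal g Γ f ε) u (vecTimeDeriv (alongLine dF u V)) (dG u) +
        pairing (weaklyNonlocal g Γ f ε) u (dF u) (vecTimeDeriv (alongLine dG u V)) +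
        linearPairing g Γ f ε u V (dF u) (dG u)) 0 := by
  obtain ⟨ρ, hρ, -, -, hfam⟩ := exists_isSmoothFamily_variation hc.isOpen hu hV hV
  obtain ⟨r, ⟨h1, h2⟩, hr⟩ := ((eventually_isTestFamily_alongLine hc.isOpen hF hu hV).and
    (eventually_isTestFamily_alongLine hc.isOpen hG hu hV)).and (Ioo_mem_nhdsGT hρ) |>.exists
  have hw : IsVecFamily (Ioo (-r) r) fun q : ℝ × ℝ => u q.2 + q.1 • V q.2 := by
    refine ⟨h1.isOpen, h1.zero_mem, ContDiff.contDiffOn ?_⟩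
    have := hu.1
    have := hV.smooth
    fun_prop
  have hwU : ∀ t ∈ Ioo (-r) r, ∀ x, u x + t • V x ∈ U := by
    intro t ht x
    obtain ⟨K, -, hKU, hK⟩ := hfam (Pi.single 0 t) (by
      rw [mem_ball_zero_iff, Pi.norm_single]
      exact (abs_lt.2 ht).trans hr.2)
    have := hKU (hK.self_of_nhds x)
    rwa [variation_single_zero] at this
  have hvd : vecTimeDeriv (fun q : ℝ × ℝ => u q.2 + q.1 • V q.2) = V := by
    funext x i
    have : HasDerivAt (fun t : ℝ => u x i + t * V x i) (V x i) 0 := by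
      simpa using ((hasDerivAt_id (0 : ℝ)).mul_const (V x i)).const_add (u x i)
    exact this.deriv
  have key := hasDerivAt_pairing (ε := ε) hc hw hwU h1 h2
  rw [hvd] at key
  simp only [alongLine, zero_smul, add_zero] at key
  exact key

/-- The variational derivative of a linear functional is constant, so the second variations drop out
and only the linearized operator remains. -/
theorem hasDerivAt_poissonBracket_linear (hc : SmoothCoefficients U g Γ f)
    (hφ : IsTestVec φ) (hψ : IsTestVec ψ) (hχ : IsTestVec χ) (hu : IsFieldIn U u) :
    HasDerivAt (fun s : ℝ => poissonBracket (weaklyNonlocal g Γ f ε) (fun _ => φ) (fun _ => ψ)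
      (u + s • weaklyNonlocal g Γ f ε u χ)) (jacobiTerm g Γ f ε u φ ψ χ) 0 := by
  have h := hasDerivAt_poissonBracket (ε := ε) hc (isVariationalDerivative_linear hφ)
    (isVariationalDerivative_linear hψ) hu (hχ.isBoundedSmooth_weaklyNonlocal (ε := ε) hc hu)
  refine h.congr_deriv ?_
  have h0 : ∀ (ρ V : ℝ → Fin n → ℝ), vecTimeDeriv (alongLine (fun _ => ρ) u V) = 0 := fun ρ V => by
    funext x i
    simp [vecTimeDeriv, timeDeriv, alongLine]
  rw [h0, h0, jacobiTerm]
  simp [pairing, weaklyNonlocal, hydroOperator, tailOperator, dxInv]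

/-- The operator `weaklyNonlocal g Γ f ε` is Hamiltonian if and only if it is skew-symmetric and
satisfies the Jacobi identity on test functions. -/
theorem isHamiltonian_weaklyNonlocal_iff (hc : SmoothCoefficients U g Γ f) :
    IsHamiltonian U (weaklyNonlocal g Γ f ε) ↔
      IsSkewOn U (weaklyNonlocal g Γ f ε) ∧ ∀ u, IsFieldIn U u → JacobiAt g Γ f ε u := by
  constructor
  · rintro ⟨hskew, hjac⟩
    refine ⟨fun u φ ψ hu hφ hψ => hskew _ _ _ _ (isVariationalDerivative_linear hφ)
      (isVariationalDerivative_linear hψ) u hu, fun u hu φ ψ χ hφ hψ hχ => ?_⟩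
    obtain ⟨a, b, c, ha, hb, hc', habc⟩ := hjac _ _ _ _ _ _ (isVariationalDerivative_linear hφ)
      (isVariationalDerivative_linear hψ) (isVariationalDerivative_linear hχ) u hu
    rw [← ha.unique (hasDerivAt_poissonBracket_linear hc hφ hψ hχ hu),
      ← hb.unique (hasDerivAt_poissonBracket_linear hc hψ hχ hφ hu),
      ← hc'.unique (hasDerivAt_poissonBracket_linear hc hχ hφ hψ hu), habc]
  · rintro ⟨hskew, hjac⟩
    refine ⟨fun F G dF dG hF hG u hu => hskew u _ _ hu (hF.isTestVec hc.isOpen hu)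
      (hG.isTestVec hc.isOpen hu), fun F G H dF dG dH hF hG hH u hu => ?_⟩
    have tF := hF.isTestVec hc.isOpen hu
    have tG := hG.isTestVec hc.isOpen hu
    have tH := hH.isTestVec hc.isOpen hu
    have vF := tF.isBoundedSmooth_weaklyNonlocal (ε := ε) hc hu
    have vG := tG.isBoundedSmooth_weaklyNonlocal (ε := ε) hc hu
    have vH := tH.isBoundedSmooth_weaklyNonlocal (ε := ε) hc hu
    refine ⟨_, _, _, hasDerivAt_poissonBracket hc hF hG hu vH,
      hasDerivAt_poissonBracket hc hG hH hu vF, hasDerivAt_poissonBracket hc hH hF hu vG, ?_⟩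
    have htest : ∀ {F : (ℝ → Fin n → ℝ) → ℝ} {dF : (ℝ → Fin n → ℝ) → ℝ → Fin n → ℝ}
        {V : ℝ → Fin n → ℝ}, IsVariationalDerivative U F dF → IsBoundedSmooth V →
        IsTestVec (vecTimeDeriv (alongLine dF u V)) := fun hF hV =>
      (eventually_isTestFamily_alongLine hc.isOpen hF hu hV).exists.elim
        fun _ h => h.isTestVec_vecTimeDeriv
    -- Skewness puts every second-variation term in the form ∫ F''[V]·W with V, W Hamiltonian vector
    -- fields. Each functional contributes two such terms, with opposite signs and with V, W
    -- exchanged, which cancel by symmetry.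
    rw [hskew u (dF u) _ hu tF (htest hG vH), hskew u (dG u) _ hu tG (htest hH vF),
      hskew u (dH u) _ hu tH (htest hF vG)]
    have sF := integral_second_variation_symmetric hc.isOpen hF hu vH vG
    have sG := integral_second_variation_symmetric hc.isOpen hG hu vF vH
    have sH := integral_second_variation_symmetric hc.isOpen hH hu vG vF
    have hj := hjac u hu _ _ _ tF tG tH
    simp only [jacobiTerm] at hj
    simp only [pairing]
    linear_combination hj + sF + sG + sH

end HamiltonianCriterion

/-! ### Pointwise consequences of skew-symmetry. -/

section Skewness

variable {n : ℕ} {U : Set (Fin n → ℝ)} {g : (Fin n → ℝ) → Matrix (Fin n) (Fin n) ℝ}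
    {Γ : (Fin n → ℝ) → Fin n → Fin n → Fin n → ℝ} {f : (Fin n → ℝ) → Fin n → ℝ} {ε : ℝ}
    {u φ ψ : ℝ → Fin n → ℝ}

theorem fderiv_apply_eq_sum_partialDeriv (h : (Fin n → ℝ) → ℝ) (u v : Fin n → ℝ) :
    fderiv ℝ h u v = ∑ k, partialDeriv h k u * v k := by
  conv_lhs => rw [pi_eq_sum_univ' v]
  simp only [map_sum, map_smul, smul_eq_mul, partialDeriv]
  exact Finset.sum_congr rfl fun k _ => mul_comm _ _

theorem ContDiffOn.partialDeriv {h : (Fin n → ℝ) → ℝ} (hU : IsOpen U) (hh : ContDiffOn ℝ ∞ h U)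
    (k : Fin n) : ContDiffOn ℝ ∞ (partialDeriv h k) U :=
  (hh.fderiv_of_isOpen (m := ∞) hU (by norm_num)).clm_apply contDiffOn_const

theorem hasDerivAt_component {v : ℝ → Fin n → ℝ} (hv : ContDiff ℝ ∞ v) (k : Fin n) (x : ℝ) :
    HasDerivAt (fun y => v y k) (deriv (fun y => v y k) x) x :=
  ((contDiff_infty_iff_deriv.1 (contDiff_component hv k)).1 x).hasDerivAt

theorem IsSmoothIn.hasDerivAt_comp (hu : IsSmoothIn U u) (hU : IsOpen U) {h : (Fin n → ℝ) → ℝ}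
    (hh : ContDiffOn ℝ ∞ h U) (x : ℝ) : HasDerivAt (fun y => h (u y))
      (∑ k, partialDeriv h k (u x) * deriv (fun y => u y k) x) x := by
  rw [← fderiv_apply_eq_sum_partialDeriv (v := fun k => deriv (fun y => u y k) x)]
  have h1 : HasFDerivAt h (fderiv ℝ h (u x)) (u x) :=
    ((hh.contDiffAt (hU.mem_nhds (hu.mem x))).differentiableAt (by norm_num)).hasFDerivAt
  exact h1.comp_hasDerivAt x (hasDerivAt_pi.2 fun k => hasDerivAt_component hu.smooth k x)

/-- Skew-symmetry of `weaklyNonlocal` only concerns the local part. -/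
theorem isSkewOn_weaklyNonlocal_iff (hc : SmoothCoefficients U g Γ f) :
    IsSkewOn U (weaklyNonlocal g Γ f ε) ↔ ∀ u φ ψ, IsFieldIn U u → IsTestVec φ → IsTestVec ψ →
      (∫ x, ∑ i, φ x i * hydroOperator g Γ u ψ x i) +
        (∫ x, ∑ i, ψ x i * hydroOperator g Γ u φ x i) = 0 := by
  refine forall₃_congr fun u φ ψ => forall₃_congr fun hu hφ hψ => ?_
  have hu := hu.isSmoothIn
  rw [pairing_weaklyNonlocal hc hu hφ hψ, pairing_weaklyNonlocal hc hu hψ hφ,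
    integral_mul_dxInv_swap (hφ.contract hc hu).integrable (hψ.contract hc hu).integrable]
  constructor <;> intro h <;> linear_combination h

/-- The test vector `α eᵢ`. -/
def singleTest (α : ℝ → ℝ) (i : Fin n) (x : ℝ) : Fin n → ℝ := Pi.single i (α x)

theorem singleTest_same (α : ℝ → ℝ) (i : Fin n) : (fun x => singleTest α i x i) = α := by
  funext x; simp [singleTest]

theorem singleTest_of_ne (α : ℝ → ℝ) {i j : Fin n} (h : j ≠ i) :
    (fun x => singleTest α i x j) = fun _ => 0 := by
  funext x; simp [singleTest, h]

theorem IsTest.singleTest {α : ℝ → ℝ} (hα : IsTest α) (i : Fin n) : IsTestVec (singleTest α i) := by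
  intro j
  rcases eq_or_ne j i with rfl | h
  · rwa [singleTest_same]
  · rw [singleTest_of_ne α h]; exact IsTest.zero

theorem deriv_singleTest (α : ℝ → ℝ) (i j : Fin n) (x : ℝ) :
    deriv (fun y => singleTest α i y j) x = singleTest (deriv α) i x j := by
  rcases eq_or_ne j i with rfl | h
  · rw [singleTest_same]; simp [singleTest]
  · rw [singleTest_of_ne α h]; simp [singleTest, h]

theorem sum_mul_singleTest (c : Fin n → ℝ) (α : ℝ → ℝ) (i : Fin n) (x : ℝ) :
    ∑ j, c j * singleTest α i x j = c i * α x := by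
  simp [singleTest, Pi.single_apply]

theorem sum_singleTest_mul (c : Fin n → ℝ) (α : ℝ → ℝ) (i : Fin n) (x : ℝ) :
    ∑ j, singleTest α i x j * c j = α x * c i := by
  simp [singleTest, Pi.single_apply]

theorem hydroOperator_singleTest (β : ℝ → ℝ) (i j : Fin n) (x : ℝ) :
    hydroOperator g Γ u (singleTest β j) x i =
      g (u x) i j * deriv β x + (∑ k, Γ (u x) i j k * deriv (fun y => u y k) x) * β x := by
  simp only [hydroOperator, deriv_singleTest, Finset.sum_add_distrib, ← Finset.sum_mul]
  rw [sum_mul_singleTest, sum_mul_singleTest fun j => ∑ k, Γ (u x) i j k * deriv (fun y => u y k) x]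

theorem isFieldIn_const {u₀ : Fin n → ℝ} (h : u₀ ∈ U) : IsFieldIn U fun _ => u₀ :=
  ⟨contDiff_const, {u₀}, isCompact_singleton, by simpa using h, by simp⟩

/-- A bump function `β`, supported in `[-1, 1]`, and a function equal to `1` near `[-1, 1]`. -/
theorem exists_isTest_bump : ∃ α β : ℝ → ℝ, IsTest α ∧ IsTest β ∧
    (∀ x, |x| < 2 → α =ᶠ[𝓝 x] fun _ => 1) ∧ (∀ x, 1 < |x| → β =ᶠ[𝓝 x] fun _ => 0) ∧
    β 0 = 1 ∧ 0 < ∫ x, β x ∧ 0 < ∫ x, deriv β x * deriv β x := by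
  -- The plateau of radius 2 contains a neighbourhood of the support [-1, 1] of the second bump.
  let a : ContDiffBump (0 : ℝ) := ⟨2, 3, by norm_num, by norm_num⟩
  let b : ContDiffBump (0 : ℝ) := ⟨1 / 2, 1, by norm_num, by norm_num⟩
  have hb : IsTest b := ⟨b.contDiff, b.hasCompactSupport⟩
  refine ⟨a, b, ⟨a.contDiff, a.hasCompactSupport⟩, hb, fun x hx => ?_, fun x hx => ?_,
    b.one_of_mem_closedBall (by simp [b]), b.integral_pos, ?_⟩
  · exact a.eventuallyEq_one_of_mem_ball (by simpa using hx)
  · have : IsOpen {y : ℝ | 1 < |y|} := isOpen_lt continuous_const continuous_abs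
    filter_upwards [this.mem_nhds hx] with y hy
    exact b.zero_of_le_dist (by simpa using le_of_lt hy)
  · obtain ⟨x, hx⟩ : ∃ x, deriv b x ≠ 0 := by
      by_contra! h
      -- A zero derivative would make the bump constant, but it is 1 at 0 and 0 at 5.
      have h1 := is_const_of_deriv_eq_zero (contDiff_infty_iff_deriv.1 hb.smooth).1 h 0 5
      rw [b.one_of_mem_closedBall (by simp [b]), b.zero_of_le_dist (by simp [b])] at h1
      exact one_ne_zero h1
    exact (hb.deriv.mul_smooth hb.deriv.smooth).continuous.integral_pos_of_hasCompactSupport_nonneg_nonzero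
      (hb.deriv.mul_smooth hb.deriv.smooth).compact (fun x => mul_self_nonneg _) (mul_self_ne_zero.2 hx)

theorem integral_mul_deriv_deriv {β : ℝ → ℝ} (hβ : IsTest β) :
    ∫ x, β x * deriv (deriv β) x = -∫ x, deriv β x * deriv β x := by
  have h := (hβ.mul_smooth hβ.deriv.smooth).integral_deriv
  have h1 : deriv (fun x => β x * deriv β x) =
      fun x => deriv β x * deriv β x + β x * deriv (deriv β) x := funext fun x =>
    ((hβ.hasDerivAt x).mul (hβ.deriv.hasDerivAt x)).deriv
  rw [h1, integral_add (hβ.deriv.mul_smooth hβ.deriv.smooth).integrable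
    (hβ.mul_smooth hβ.deriv.deriv.smooth).integrable] at h
  linarith

/-- The pointwise relations equivalent to skew-symmetry of `gⁱʲ ∂ₓ + Γⁱʲₖ uᵏₓ`. -/
structure SkewRelations (U : Set (Fin n → ℝ)) (g : (Fin n → ℝ) → Matrix (Fin n) (Fin n) ℝ)
    (Γ : (Fin n → ℝ) → Fin n → Fin n → Fin n → ℝ) : Prop where
  symm : ∀ u ∈ U, ∀ i j, g u i j = g u j i
  compat : ∀ u ∈ U, ∀ i j k, partialDeriv (fun v => g v i j) k u = Γ u i j k + Γ u j i k

/-- On constant fields Γ disappears and symmetry of g is left. The relation for Γ then comes from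
fields moving in the coordinate direction k, after a total derivative is split off. -/
theorem IsSkewOn.skewRelations (hc : SmoothCoefficients U g Γ f)
    (h : IsSkewOn U (weaklyNonlocal g Γ f ε)) : SkewRelations U g Γ := by
  rw [isSkewOn_weaklyNonlocal_iff hc] at h
  obtain ⟨-, β, -, hβ, -, -, hβ0, hβi, hβ'⟩ := exists_isTest_bump
  have hsymm : ∀ u ∈ U, ∀ i j, g u i j = g u j i := by
    intro u₀ hu₀ i j
    have := h _ _ _ (isFieldIn_const hu₀) (hβ.deriv.singleTest i) (hβ.singleTest j)
    simp only [sum_singleTest_mul, hydroOperator_singleTest, deriv_const, mul_zero,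
      Finset.sum_const_zero, zero_mul, add_zero] at this
    simp only [mul_left_comm _ (g u₀ _ _), integral_const_mul, integral_mul_deriv_deriv hβ] at this
    have h2 : (g u₀ i j - g u₀ j i) * ∫ x, deriv β x * deriv β x = 0 := by linear_combination this
    exact sub_eq_zero.1 ((mul_eq_zero.1 h2).resolve_right hβ'.ne')
  refine ⟨hsymm, fun u₀ hu₀ i j k => ?_⟩
  obtain ⟨δ, hδ, hδU⟩ := Metric.nhds_basis_closedBall.mem_iff.1 (hc.isOpen.mem_nhds hu₀)
  -- This field passes through u₀ at x = 0 with velocity δ eₖ, and the sine keeps it in the closed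
  -- ball of radius δ inside U.
  set u : ℝ → Fin n → ℝ := fun x => u₀ + Pi.single k (δ * Real.sin x) with hu_def
  have hd : ∀ x l, deriv (fun y => u y l) x = (Pi.single k (δ * Real.cos x) : Fin n → ℝ) l := by
    intro x l
    rcases eq_or_ne l k with rfl | hl
    · simp [hu_def]
    · simp [hu_def, hl]
  have hu : IsFieldIn U u := by
    refine ⟨contDiff_pi.2 fun l => ?_, Metric.closedBall u₀ δ, isCompact_closedBall _ _, hδU,
      fun x => ?_⟩
    · rcases eq_or_ne l k with rfl | hl
      · simp only [hu_def, Pi.add_apply, Pi.single_eq_same]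
        exact contDiff_const.add (contDiff_const.mul Real.contDiff_sin)
      · simp only [hu_def, Pi.add_apply, Pi.single_eq_of_ne hl]
        exact contDiff_const
    · rw [mem_closedBall_iff_norm, hu_def]
      simp only [add_sub_cancel_left, Pi.norm_single, norm_mul, Real.norm_eq_abs, abs_of_pos hδ]
      exact mul_le_of_le_one_right hδ.le (Real.abs_sin_le_one x)
  have hus := hu.isSmoothIn
  set D : (Fin n → ℝ) → ℝ := fun v =>
    Γ v i j k + Γ v j i k - partialDeriv (fun v => g v i j) k v with hD
  have hDs : ContDiffOn ℝ ∞ D U := ((hc.symbol i j k).add (hc.symbol j i k)).sub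
    ((hc.metric i j).partialDeriv hc.isOpen k)
  have hk : ContDiff ℝ ∞ fun x => D (u x) * (δ * Real.cos x) :=
    (hus.comp hDs).mul (contDiff_const.mul Real.contDiff_cos)
  have hzero : ∀ α, IsTest α → ∀ β, IsTest β → ∫ x, α x * (β x * (D (u x) * (δ * Real.cos x))) = 0 := by
    intro α hα β hβ
    have hM : IsTest fun x => g (u x) i j * (α x * β x) :=
      IsTest.smooth_mul (hus.comp (hc.metric i j)) (hα.mul_smooth hβ.smooth)
    have e1 : ∀ c : Fin n → ℝ, ∀ x, ∑ l, c l * deriv (fun y => u y l) x = c k * (δ * Real.cos x) := by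
      intro c x
      simp only [hd]
      simp [Pi.single_apply]
    have key := h _ _ _ hu (hα.singleTest i) (hβ.singleTest j)
    rw [← integral_add ((hα.singleTest i).dot ((hβ.singleTest j).hydroOperator hc hus).contDiff).integrable
      ((hβ.singleTest j).dot ((hα.singleTest i).hydroOperator hc hus).contDiff).integrable] at key
    -- The symmetrized integrand is a total derivative plus αβ times the defect D of the wanted
    -- relation.
    have hpt : ∀ x, (∑ l, singleTest α i x l * hydroOperator g Γ u (singleTest β j) x l) +
        ∑ l, singleTest β j x l * hydroOperator g Γ u (singleTest α i) x l =
        deriv (fun x => g (u x) i j * (α x * β x)) x +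
          α x * (β x * (D (u x) * (δ * Real.cos x))) := by
      intro x
      have hd := ((hus.hasDerivAt_comp hc.isOpen (hc.metric i j) x).mul
        ((hα.hasDerivAt x).mul (hβ.hasDerivAt x))).deriv
      simp only [sum_singleTest_mul, hydroOperator_singleTest, e1] at hd ⊢
      refine Eq.trans ?_ (congrArg (· + _) hd.symm)
      rw [hsymm _ (hus.mem x) j i, hD]
      simp only [Pi.mul_apply]
      ring
    simp only [hpt] at key
    rwa [integral_add hM.deriv.integrable (hα.mul_smooth (hβ.mul_smooth hk).smooth).integrable,
      hM.integral_deriv, zero_add] at key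
  -- Since α is arbitrary, the fundamental lemma of the calculus of variations applies; continuity
  -- then allows evaluation at x = 0, where β and the cosine equal 1.
  have hae : ∀ᵐ x, β x * (D (u x) * (δ * Real.cos x)) = 0 :=
    ae_eq_zero_of_integral_contDiff_smul_eq_zero
      (hβ.mul_smooth hk).continuous.locallyIntegrable
      fun α hα hα' => hzero α ⟨hα, hα'⟩ β hβ
  have h0 := congrFun (((hβ.mul_smooth hk).continuous.ae_eq_iff_eq volume continuous_const).1 hae) 0
  have hu0 : u 0 = u₀ := by simp [hu_def]
  simp only [hβ0, hu0, Real.cos_zero, mul_one, one_mul] at h0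
  have h1 := (mul_eq_zero.1 h0).resolve_right hδ.ne'
  rw [hD] at h1
  linear_combination -h1

end Skewness

/-! ### Expansion of the Jacobi identity in powers of the tail coefficient. -/

section JacobiDecomposition

variable {n : ℕ} {U : Set (Fin n → ℝ)} {g : (Fin n → ℝ) → Matrix (Fin n) (Fin n) ℝ}
    {Γ : (Fin n → ℝ) → Fin n → Fin n → Fin n → ℝ} {f : (Fin n → ℝ) → Fin n → ℝ} {ε : ℝ}
    {u φ ψ χ : ℝ → Fin n → ℝ}

theorem hydroLinear_add_smul {v w : ℝ → Fin n → ℝ} (hv : ContDiff ℝ ∞ v) (hw : ContDiff ℝ ∞ w)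
    (x : ℝ) (i : Fin n) : hydroLinear g Γ u (v + ε • w) ψ x i =
      hydroLinear g Γ u v ψ x i + ε * hydroLinear g Γ u w ψ x i := by
  have hd : ∀ k, deriv (fun y => (v + ε • w) y k) x =
      deriv (fun y => v y k) x + ε * deriv (fun y => w y k) x := fun k =>
    ((hasDerivAt_component hv k x).add ((hasDerivAt_component hw k x).const_mul ε)).deriv
  simp only [hydroLinear, hd, Finset.mul_sum, ← Finset.sum_add_distrib]
  refine Finset.sum_congr rfl fun j _ => ?_
  simp only [Pi.add_apply, Pi.smul_apply, map_add, map_smul, smul_eq_mul]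
  rw [mul_add ε, Finset.mul_sum, add_add_add_comm, ← Finset.sum_add_distrib]
  exact congrArg₂ _ (by ring) (Finset.sum_congr rfl fun k _ => by ring)

theorem contractLinear_add_smul {v w : ℝ → Fin n → ℝ} (x : ℝ) :
    contractLinear f u (v + ε • w) ψ x =
      contractLinear f u v ψ x + ε * contractLinear f u w ψ x := by
  simp only [contractLinear, Finset.mul_sum, ← Finset.sum_add_distrib]
  refine Finset.sum_congr rfl fun j _ => ?_
  simp only [Pi.add_apply, Pi.smul_apply, map_add, map_smul, smul_eq_mul]
  ring

/-- At each point the tail is a scalar multiple of f(u). Hence the quadratic terms carry a product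
of two factors ∂⁻¹(f·), symmetric in the two covectors. -/
theorem contractLinear_tailOperator (x : ℝ) :
    contractLinear f u (tailOperator f u χ) ψ x =
      dxInv (contract f u χ) x * contractLinear f u (fun y => f (u y)) ψ x := by
  have h : tailOperator f u χ x = dxInv (contract f u χ) x • f (u x) := by
    funext i
    simp only [tailOperator, Pi.smul_apply, smul_eq_mul]
    rw [mul_comm (f (u x) i)]; rfl
  simp only [contractLinear, h, map_smul, smul_eq_mul, Finset.mul_sum, mul_assoc]

/-- The integrand of the Jacobi identity of the local operator. -/
noncomputable def localTerm (g : (Fin n → ℝ) → Matrix (Fin n) (Fin n) ℝ)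
    (Γ : (Fin n → ℝ) → Fin n → Fin n → Fin n → ℝ) (u φ ψ χ : ℝ → Fin n → ℝ) (x : ℝ) : ℝ :=
  ∑ i, φ x i * hydroLinear g Γ u (hydroOperator g Γ u χ) ψ x i

/-- The part of the Jacobi identity that is linear in the nonlocal tail, with the terms containing
`∂ₓ⁻¹(fχ)` collected. -/
noncomputable def mixedTerm (g : (Fin n → ℝ) → Matrix (Fin n) (Fin n) ℝ)
    (Γ : (Fin n → ℝ) → Fin n → Fin n → Fin n → ℝ) (f : (Fin n → ℝ) → Fin n → ℝ)
    (u φ ψ χ : ℝ → Fin n → ℝ) (x : ℝ) : ℝ :=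
  (∑ i, φ x i * hydroLinear g Γ u (tailOperator f u χ) ψ x i) +
    (contractLinear f u (hydroOperator g Γ u φ) ψ x -
      contractLinear f u (hydroOperator g Γ u ψ) φ x) * dxInv (contract f u χ) x

theorem isTest_localTerm (hc : SmoothCoefficients U g Γ f) (hu : IsSmoothIn U u)
    (hφ : IsTestVec φ) (hψ : IsTestVec ψ) (hχ : IsTestVec χ) :
    IsTest (localTerm g Γ u φ ψ χ) :=
  hφ.dot (hψ.hydroLinear hc hu (hχ.hydroOperator hc hu).contDiff).contDiff

theorem isTest_mixedTerm (hc : SmoothCoefficients U g Γ f) (hu : IsSmoothIn U u)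
    (hφ : IsTestVec φ) (hψ : IsTestVec ψ) (hχ : IsTestVec χ) :
    IsTest (mixedTerm g Γ f u φ ψ χ) :=
  (hφ.dot (hψ.hydroLinear hc hu (hχ.contDiff_tailOperator hc hu)).contDiff).add
    (((hψ.contractLinear hc hu (hφ.hydroOperator hc hu).contDiff).sub
      (hφ.contractLinear hc hu (hψ.hydroOperator hc hu).contDiff)).mul_smooth
      (hχ.contract hc hu).contDiff_dxInv)

/-- By skew-adjointness ∂⁻¹ is moved onto the undifferentiated factor f·φ, which produces the minus
signs; then the coefficients of 1, ε and ε² are collected. -/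
theorem jacobiTerm_eq (hc : SmoothCoefficients U g Γ f) (hu : IsSmoothIn U u)
    (hφ : IsTestVec φ) (hψ : IsTestVec ψ) (hχ : IsTestVec χ) :
    jacobiTerm g Γ f ε u φ ψ χ = (∫ x, localTerm g Γ u φ ψ χ x) +
      ε * ((∫ x, ∑ i, φ x i * hydroLinear g Γ u (tailOperator f u χ) ψ x i) +
        (∫ x, contractLinear f u (hydroOperator g Γ u χ) φ x * dxInv (contract f u ψ) x) -
        ∫ x, contractLinear f u (hydroOperator g Γ u χ) ψ x * dxInv (contract f u φ) x) +
      ε ^ 2 * ((∫ x, contractLinear f u (fun y => f (u y)) φ x *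
          (dxInv (contract f u χ) x * dxInv (contract f u ψ) x)) -
        ∫ x, contractLinear f u (fun y => f (u y)) ψ x *
          (dxInv (contract f u χ) x * dxInv (contract f u φ) x)) := by
  have hB := (hχ.hydroOperator hc hu).contDiff
  have hT := hχ.contDiff_tailOperator hc hu
  have hP := hχ.contDiff_weaklyNonlocal (ε := ε) hc hu
  rw [jacobiTerm, linearPairing, integral_mul_dxInv_swap (hφ.contract hc hu).integrable
    (hψ.contractLinear hc hu hP).integrable]
  have e1 : ∫ x, ∑ i, φ x i * hydroLinear g Γ u (weaklyNonlocal g Γ f ε u χ) ψ x i =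
      (∫ x, localTerm g Γ u φ ψ χ x) +
        ε * ∫ x, ∑ i, φ x i * hydroLinear g Γ u (tailOperator f u χ) ψ x i := by
    rw [← integral_const_mul, ← integral_add (isTest_localTerm hc hu hφ hψ hχ).integrable
      ((hφ.dot (hψ.hydroLinear hc hu hT).contDiff).integrable.const_mul ε)]
    refine integral_congr_ae (ae_of_all _ fun x => ?_)
    simp only [localTerm, Finset.mul_sum, ← Finset.sum_add_distrib]
    refine Finset.sum_congr rfl fun i _ => ?_
    rw [← mul_left_comm, ← mul_add, ← hydroLinear_add_smul hB hT]; rfl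
  have e2 : ∀ {φ ψ : ℝ → Fin n → ℝ}, IsTestVec φ → IsTestVec ψ →
      ∫ x, contractLinear f u (weaklyNonlocal g Γ f ε u χ) φ x * dxInv (contract f u ψ) x =
      (∫ x, contractLinear f u (hydroOperator g Γ u χ) φ x * dxInv (contract f u ψ) x) +
        ε * ∫ x, contractLinear f u (fun y => f (u y)) φ x *
          (dxInv (contract f u χ) x * dxInv (contract f u ψ) x) := by
    intro φ ψ hφ hψ
    have hX := (hχ.contract hc hu).contDiff_dxInv
    have hY := (hψ.contract hc hu).contDiff_dxInv
    have hf : ContDiff ℝ ∞ fun y => f (u y) := contDiff_pi.2 fun i => hu.comp (hc.vector i)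
    rw [← integral_const_mul, ← integral_add
      ((hφ.contractLinear hc hu hB).mul_smooth hY).integrable
      (((hφ.contractLinear hc hu hf).mul_smooth (hX.mul hY)).integrable.const_mul ε)]
    refine integral_congr_ae (ae_of_all _ fun x => ?_)
    have : contractLinear f u (weaklyNonlocal g Γ f ε u χ) φ x = _ := contractLinear_add_smul x
    simp only [this, contractLinear_tailOperator]
    ring
  rw [e1, e2 hφ hψ, e2 hψ hφ]
  ring

/-- The cyclic sum in the Jacobi identity: the terms quadratic in the nonlocal tail cancel. -/
theorem jacobiTerm_cyclic_sum (hc : SmoothCoefficients U g Γ f) (hu : IsSmoothIn U u)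
    (hφ : IsTestVec φ) (hψ : IsTestVec ψ) (hχ : IsTestVec χ) :
    jacobiTerm g Γ f ε u φ ψ χ + jacobiTerm g Γ f ε u ψ χ φ + jacobiTerm g Γ f ε u χ φ ψ =
      ((∫ x, localTerm g Γ u φ ψ χ x) + (∫ x, localTerm g Γ u ψ χ φ x) +
        ∫ x, localTerm g Γ u χ φ ψ x) +
      ε * ((∫ x, mixedTerm g Γ f u φ ψ χ x) + (∫ x, mixedTerm g Γ f u ψ χ φ x) +
        ∫ x, mixedTerm g Γ f u χ φ ψ x) := by
  have hm : ∀ {φ ψ χ : ℝ → Fin n → ℝ}, IsTestVec φ → IsTestVec ψ → IsTestVec χ →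
      ∫ x, mixedTerm g Γ f u φ ψ χ x =
        (∫ x, ∑ i, φ x i * hydroLinear g Γ u (tailOperator f u χ) ψ x i) +
        ((∫ x, contractLinear f u (hydroOperator g Γ u φ) ψ x * dxInv (contract f u χ) x) -
        ∫ x, contractLinear f u (hydroOperator g Γ u ψ) φ x * dxInv (contract f u χ) x) := by
    intro φ ψ χ hφ hψ hχ
    have hX := (hχ.contract hc hu).contDiff_dxInv
    have i1 := (hφ.dot (hψ.hydroLinear hc hu (hχ.contDiff_tailOperator hc hu)).contDiff)
    have i2 := (hψ.contractLinear hc hu (hφ.hydroOperator hc hu).contDiff).mul_smooth hX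
    have i3 := (hφ.contractLinear hc hu (hψ.hydroOperator hc hu).contDiff).mul_smooth hX
    rw [← integral_sub i2.integrable i3.integrable,
      ← integral_add i1.integrable (i2.sub i3).integrable]
    simp only [mixedTerm, sub_mul]
  rw [jacobiTerm_eq hc hu hφ hψ hχ, jacobiTerm_eq hc hu hψ hχ hφ, jacobiTerm_eq hc hu hχ hφ hψ,
    hm hφ hψ hχ, hm hψ hχ hφ, hm hχ hφ hψ]
  -- Once the products of nonlocal factors are put in a common order, each quadratic integral occurs
  -- once with each sign. The linear terms regroup by their nonlocal factor.
  simp only [mul_comm (dxInv (contract f u χ) _) (dxInv (contract f u ψ) _),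
    mul_comm (dxInv (contract f u φ) _) (dxInv (contract f u χ) _),
    mul_comm (dxInv (contract f u ψ) _) (dxInv (contract f u φ) _)]
  ring

end JacobiDecomposition

/-! ### The part linear in the tail: total derivatives, Lie derivatives and a 3-form. -/

section MixedTerm

/-- The Lie derivative along `f` of the contravariant metric `gⁱʲ`. -/
noncomputable def lieMetric {n : ℕ} (g : (Fin n → ℝ) → Matrix (Fin n) (Fin n) ℝ)
    (f : (Fin n → ℝ) → Fin n → ℝ) (u : Fin n → ℝ) (i j : Fin n) : ℝ :=
  ∑ k, (f u k * partialDeriv (fun v => g v i j) k u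
    - g u k j * partialDeriv (fun v => f v i) k u
    - g u i k * partialDeriv (fun v => f v j) k u)

/-- The coefficient of `uᵐₓ` in the Lie derivative along `f` of `gⁱʲ ∂ₓ + Γⁱʲₖ uᵏₓ`. -/
noncomputable def lieSymbol {n : ℕ} (g : (Fin n → ℝ) → Matrix (Fin n) (Fin n) ℝ)
    (Γ : (Fin n → ℝ) → Fin n → Fin n → Fin n → ℝ) (f : (Fin n → ℝ) → Fin n → ℝ)
    (u : Fin n → ℝ) (i j m : Fin n) : ℝ :=
  ∑ l, (f u l * partialDeriv (fun v => Γ v i j m) l u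
    + Γ u i j l * partialDeriv (fun v => f v l) m u
    - Γ u l j m * partialDeriv (fun v => f v i) l u
    - Γ u i l m * partialDeriv (fun v => f v j) l u
    - g u i l * partialDeriv (partialDeriv (fun v => f v j) l) m u)

/-- The pointwise identity behind `mixedTerm_eq`, with jets as free letters: p, q are φ, ψ; p', q'
their x-derivatives; up is uₓ; X is ∂⁻¹(fχ) and c = fχ its derivative. The first bracket on the
right is the expanded derivative of the flux. -/
theorem mixed_algebra (p p' q q' up f : Fin 2 → ℝ) (X c : ℝ) (gm df : Fin 2 → Fin 2 → ℝ)
    (dg G ddf : Fin 2 → Fin 2 → Fin 2 → ℝ) (dG : Fin 2 → Fin 2 → Fin 2 → Fin 2 → ℝ)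
    (hsymm : ∀ i j, gm i j = gm j i) (hcompat : ∀ i j k, dg i j k = G i j k + G j i k) :
    (∑ i, p i * ∑ j, ((∑ l, dg i j l * (f l * X)) * q' j +
        ∑ k, ((∑ l, dG i j k l * (f l * X)) * up k +
          G i j k * ((∑ l, df k l * up l) * X + f k * c)) * q j)) +
      ((∑ j, (∑ k, df j k * ∑ i, (gm k i * p' i + ∑ m, G k i m * up m * p i)) * q j) -
        ∑ j, (∑ k, df j k * ∑ i, (gm k i * q' i + ∑ m, G k i m * up m * q i)) * p j) * X =
    (c * (∑ i, ∑ j, ∑ k, p i * (gm i k * df j k) * q j) +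
      X * ∑ i, ∑ j, ∑ k, ((p' i * (gm i k * df j k) +
        p i * ((∑ m, dg i k m * up m) * df j k + gm i k * ∑ m, ddf j k m * up m)) * q j +
        p i * (gm i k * df j k) * q' j)) +
    (X * ((∑ i, ∑ j, p i * q' j * ∑ k, (f k * dg i j k - gm k j * df i k - gm i k * df j k)) +
        ∑ i, ∑ j, ∑ m, p i * q j * up m * ∑ l, (f l * dG i j m l + G i j l * df l m -
          G l j m * df i l - G i l m * df j l - gm i l * ddf j l m)) +
      c * ∑ i, ∑ j, p i * q j * ∑ k, (G i j k * f k - gm i k * df j k)) := by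
  simp only [hcompat, Fin.sum_univ_two, hsymm 1 0]
  ring

variable {U : Set (Fin 2 → ℝ)} {g : (Fin 2 → ℝ) → Matrix (Fin 2) (Fin 2) ℝ}
    {Γ : (Fin 2 → ℝ) → Fin 2 → Fin 2 → Fin 2 → ℝ} {f : (Fin 2 → ℝ) → Fin 2 → ℝ} {ε : ℝ}
    {u φ ψ χ : ℝ → Fin 2 → ℝ}

/-- The function whose derivative is the mixed term, up to Lie derivatives and local terms. -/
noncomputable def mixedFlux (g : (Fin 2 → ℝ) → Matrix (Fin 2) (Fin 2) ℝ)
    (f : (Fin 2 → ℝ) → Fin 2 → ℝ) (u φ ψ χ : ℝ → Fin 2 → ℝ) (x : ℝ) : ℝ :=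
  dxInv (contract f u χ) x * ∑ i, ∑ j, ∑ k,
    φ x i * (g (u x) i k * partialDeriv (fun v => f v j) k (u x)) * ψ x j

/-- The mixed term modulo total derivatives. -/
noncomputable def mixedDefect (g : (Fin 2 → ℝ) → Matrix (Fin 2) (Fin 2) ℝ)
    (Γ : (Fin 2 → ℝ) → Fin 2 → Fin 2 → Fin 2 → ℝ) (f : (Fin 2 → ℝ) → Fin 2 → ℝ)
    (u φ ψ χ : ℝ → Fin 2 → ℝ) (x : ℝ) : ℝ :=
  dxInv (contract f u χ) x *
      ((∑ i, ∑ j, φ x i * deriv (fun y => ψ y j) x * lieMetric g f (u x) i j) +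
        ∑ i, ∑ j, ∑ m, φ x i * ψ x j * deriv (fun y => u y m) x * lieSymbol g Γ f (u x) i j m) +
    contract f u χ x * ∑ i, ∑ j, φ x i * ψ x j *
      ∑ k, (Γ (u x) i j k * f (u x) k - g (u x) i k * partialDeriv (fun v => f v j) k (u x))

theorem isTest_mixedFlux (hc : SmoothCoefficients U g Γ f) (hu : IsSmoothIn U u)
    (hφ : IsTestVec φ) (hψ : IsTestVec ψ) (hχ : IsTestVec χ) :
    IsTest (mixedFlux g f u φ ψ χ) :=
  IsTest.smooth_mul (hχ.contract hc hu).contDiff_dxInv <| IsTest.sum _ fun i _ =>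
    IsTest.sum _ fun j _ => IsTest.sum _ fun k _ => ((hφ i).mul_smooth
      ((hu.comp (hc.metric i k)).mul (hu.comp ((hc.vector j).partialDeriv hc.isOpen k)))).mul_smooth
      (hψ j).smooth

/-- The flux ∂⁻¹(fχ) φᵢ gⁱᵏ∂ₖfʲ ψⱼ absorbs the terms with derivatives of φ. What multiplies ∂⁻¹(fχ)
is then the Lie derivative of the local operator; the local remainder comes from differentiating
∂⁻¹(fχ). -/
theorem mixedTerm_eq (hc : SmoothCoefficients U g Γ f) (hu : IsSmoothIn U u)
    (hs : SkewRelations U g Γ) (hφ : IsTestVec φ) (hψ : IsTestVec ψ) (hχ : IsTestVec χ) (x : ℝ) :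
    mixedTerm g Γ f u φ ψ χ x =
      deriv (mixedFlux g f u φ ψ χ) x + mixedDefect g Γ f u φ ψ χ x := by
  have hX := (hχ.contract hc hu).hasDerivAt_dxInv
  have hflux : HasDerivAt (mixedFlux g f u φ ψ χ) _ x := (hX x).fun_mul <|
    HasDerivAt.fun_sum (u := Finset.univ) fun i _ => HasDerivAt.fun_sum (u := Finset.univ) fun j _ =>
      HasDerivAt.fun_sum (u := Finset.univ) fun k _ =>
      (((hφ i).hasDerivAt x).fun_mul ((hu.hasDerivAt_comp hc.isOpen (hc.metric i k) x).fun_mul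
        (hu.hasDerivAt_comp hc.isOpen ((hc.vector j).partialDeriv hc.isOpen k) x))).fun_mul
        ((hψ j).hasDerivAt x)
  have htail : ∀ k, deriv (fun y => tailOperator f u χ y k) x =
      (∑ l, partialDeriv (fun v => f v k) l (u x) * deriv (fun y => u y l) x) *
        dxInv (contract f u χ) x + f (u x) k * contract f u χ x := fun k =>
    ((hu.hasDerivAt_comp hc.isOpen (hc.vector k) x).mul (hX x)).deriv
  rw [hflux.deriv, mixedDefect]
  simp only [lieMetric, lieSymbol]
  rw [← mixed_algebra (fun i => φ x i) (fun i => deriv (fun y => φ y i) x) (fun i => ψ x i)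
    (fun i => deriv (fun y => ψ y i) x) (fun m => deriv (fun y => u y m) x) (f (u x))
    (dxInv (contract f u χ) x) (contract f u χ x) (g (u x))
    (fun j k => partialDeriv (fun v => f v j) k (u x))
    (fun i j k => partialDeriv (fun v => g v i j) k (u x)) (Γ (u x))
    (fun j k m => partialDeriv (partialDeriv (fun v => f v j) k) m (u x))
    (fun i j k l => partialDeriv (fun v => Γ v i j k) l (u x))
    (hs.symm _ (hu.mem x)) (hs.compat _ (hu.mem x))]
  simp only [mixedTerm, hydroLinear, contractLinear, htail, fderiv_apply_eq_sum_partialDeriv]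
  rfl

/-- In dimension two, the local part of the mixed term has vanishing cyclic sum. -/
theorem mixedDefect_cyclic_sum_eq_zero (hu : IsSmoothIn U u) (hs : SkewRelations U g Γ)
    (hL : ∀ v ∈ U, ∀ i j, lieMetric g f v i j = 0) {x : ℝ}
    (hS : ∀ i j m, deriv (fun y => u y m) x * lieSymbol g Γ f (u x) i j m = 0) :
    mixedDefect g Γ f u φ ψ χ x + mixedDefect g Γ f u ψ χ φ x + mixedDefect g Γ f u χ φ ψ x = 0 := by
  have hx := hu.mem x
  set T : Fin 2 → Fin 2 → ℝ := fun i j =>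
    ∑ k, (Γ (u x) i j k * f (u x) k - g (u x) i k * partialDeriv (fun v => f v j) k (u x)) with hT
  -- The compatibility of Γ with g makes the symmetrization of T equal to the Lie derivative of the
  -- metric.
  have hskew : ∀ i j, T i j + T j i = 0 := by
    intro i j
    rw [← hL _ hx i j, lieMetric, hT]
    simp only [← Finset.sum_add_distrib]
    refine Finset.sum_congr rfl fun k _ => ?_
    rw [hs.compat _ hx, hs.symm _ hx k j]; ring
  have h00 : T 0 0 = 0 := by linarith [hskew 0 0]
  have h11 : T 1 1 = 0 := by linarith [hskew 1 1]
  have h10 : T 1 0 = -T 0 1 := by linarith [hskew 0 1]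
  simp only [mixedDefect, hL _ hx, mul_assoc, hS, mul_zero, Finset.sum_const_zero, add_zero,
    zero_add, contract]
  -- What is left is the 3-form obtained by wedging f with the bivector T, evaluated on three
  -- covectors of a plane; hence it is zero.
  change (∑ l, f (u x) l * χ x l) * (∑ i, ∑ j, φ x i * (ψ x j * T i j)) +
    (∑ l, f (u x) l * φ x l) * (∑ i, ∑ j, ψ x i * (χ x j * T i j)) +
    (∑ l, f (u x) l * ψ x l) * (∑ i, ∑ j, χ x i * (φ x j * T i j)) = 0
  simp only [Fin.sum_univ_two, h00, h11, h10]
  ring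

theorem isTest_mixedDefect (hc : SmoothCoefficients U g Γ f) (hu : IsSmoothIn U u)
    (hs : SkewRelations U g Γ) (hφ : IsTestVec φ) (hψ : IsTestVec ψ) (hχ : IsTestVec χ) :
    IsTest (mixedDefect g Γ f u φ ψ χ) := by
  have h : mixedDefect g Γ f u φ ψ χ = fun x =>
      mixedTerm g Γ f u φ ψ χ x - deriv (mixedFlux g f u φ ψ χ) x := funext fun x => by
    rw [mixedTerm_eq hc hu hs hφ hψ hχ]; ring
  rw [h]
  exact (isTest_mixedTerm hc hu hφ hψ hχ).sub (isTest_mixedFlux hc hu hφ hψ hχ).deriv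

theorem integral_mixedTerm (hc : SmoothCoefficients U g Γ f) (hu : IsSmoothIn U u)
    (hs : SkewRelations U g Γ) (hφ : IsTestVec φ) (hψ : IsTestVec ψ) (hχ : IsTestVec χ) :
    ∫ x, mixedTerm g Γ f u φ ψ χ x = ∫ x, mixedDefect g Γ f u φ ψ χ x := by
  simp only [mixedTerm_eq hc hu hs hφ hψ hχ]
  rw [integral_add (isTest_mixedFlux hc hu hφ hψ hχ).deriv.integrable
    (isTest_mixedDefect hc hu hs hφ hψ hχ).integrable,
    (isTest_mixedFlux hc hu hφ hψ hχ).integral_deriv, zero_add]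

/-- The Jacobi identity of `weaklyNonlocal` is that of its local part, if `f` preserves the
local operator along the field. -/
theorem jacobiTerm_cyclic_sum_eq_local (hc : SmoothCoefficients U g Γ f) (hu : IsSmoothIn U u)
    (hs : SkewRelations U g Γ) (hL : ∀ v ∈ U, ∀ i j, lieMetric g f v i j = 0)
    (hS : ∀ x i j m, deriv (fun y => u y m) x * lieSymbol g Γ f (u x) i j m = 0)
    (hφ : IsTestVec φ) (hψ : IsTestVec ψ) (hχ : IsTestVec χ) :
    jacobiTerm g Γ f ε u φ ψ χ + jacobiTerm g Γ f ε u ψ χ φ + jacobiTerm g Γ f ε u χ φ ψ =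
      (∫ x, localTerm g Γ u φ ψ χ x) + (∫ x, localTerm g Γ u ψ χ φ x) +
        ∫ x, localTerm g Γ u χ φ ψ x := by
  rw [jacobiTerm_cyclic_sum hc hu hφ hψ hχ, integral_mixedTerm hc hu hs hφ hψ hχ,
    integral_mixedTerm hc hu hs hψ hχ hφ, integral_mixedTerm hc hu hs hχ hφ hψ]
  have h1 := isTest_mixedDefect hc hu hs hφ hψ hχ
  have h2 := isTest_mixedDefect hc hu hs hψ hχ hφ
  have h3 := isTest_mixedDefect hc hu hs hχ hφ hψ
  rw [← integral_add h1.integrable h2.integrable,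
    ← integral_add (h1.add h2).integrable h3.integrable]
  simp only [mixedDefect_cyclic_sum_eq_zero hu hs hL (hS _), integral_zero, mul_zero, add_zero]

end MixedTerm

/-! ### Evaluation on constant fields. -/

section ConstantFields

variable {n : ℕ} {U : Set (Fin n → ℝ)} {g : (Fin n → ℝ) → Matrix (Fin n) (Fin n) ℝ}
    {Γ : (Fin n → ℝ) → Fin n → Fin n → Fin n → ℝ} {f : (Fin n → ℝ) → Fin n → ℝ}
    {u₀ : Fin n → ℝ}

theorem localTerm_const_singleTest {γ : ℝ → ℝ} (hγ : IsTest γ) (α β : ℝ → ℝ)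
    (i j l : Fin n) (x : ℝ) :
    localTerm g Γ (fun _ => u₀) (singleTest α i) (singleTest β j) (singleTest γ l) x =
      α x * ((∑ m, partialDeriv (fun v => g v i j) m u₀ * g u₀ m l) * (deriv γ x * deriv β x) +
        (∑ k, Γ u₀ i j k * g u₀ k l) * (deriv (deriv γ) x * β x)) := by
  have hv : hydroOperator g Γ (fun _ => u₀) (singleTest γ l) = fun y k => g u₀ k l * deriv γ y := by
    funext y k
    rw [hydroOperator_singleTest]; simp
  have hd : ∀ k, deriv (fun y => g u₀ k l * deriv γ y) x = g u₀ k l * deriv (deriv γ) x := fun k =>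
    ((hγ.deriv.hasDerivAt x).const_mul _).deriv
  rw [localTerm, sum_singleTest_mul, hv]
  simp only [hydroLinear, deriv_const, mul_zero, zero_add, hd, deriv_singleTest,
    fderiv_apply_eq_sum_partialDeriv, Finset.sum_add_distrib, ← Finset.sum_mul]
  rw [sum_mul_singleTest fun j => ∑ k, partialDeriv (fun w => g w i j) k u₀ * (g u₀ k l * deriv γ x),
    sum_mul_singleTest fun j => ∑ k, Γ u₀ i j k * (g u₀ k l * deriv (deriv γ) x)]
  simp only [← mul_assoc, ← Finset.sum_mul]

theorem localTerm_const_singleTest_eq_zero {α β γ : ℝ → ℝ} (hγ : IsTest γ) (i j l : Fin n) {x : ℝ}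
    (h : α =ᶠ[𝓝 x] (fun _ => 0) ∨ β =ᶠ[𝓝 x] (fun _ => 0) ∨ γ =ᶠ[𝓝 x] fun _ => 0) :
    localTerm g Γ (fun _ => u₀) (singleTest α i) (singleTest β j) (singleTest γ l) x = 0 := by
  rw [localTerm_const_singleTest hγ]
  rcases h with h | h | h
  · simp [h.eq_of_nhds]
  · simp [h.eq_of_nhds, h.deriv_eq]
  · simp [h.deriv.deriv_eq, h.deriv_eq]

theorem contract_const_singleTest (γ : ℝ → ℝ) (l : Fin n) :
    contract f (fun _ => u₀) (singleTest γ l) = fun x => f u₀ l * γ x :=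
  funext fun x => sum_mul_singleTest (f u₀) γ l x

theorem sum_sum_singleTest (c : Fin n → Fin n → ℝ) (α β : ℝ → ℝ) (i j : Fin n) (x : ℝ) :
    ∑ k, ∑ l, singleTest α i x k * singleTest β j x l * c k l = α x * β x * c i j := by
  simp only [mul_assoc, ← Finset.mul_sum]
  rw [sum_singleTest_mul, sum_singleTest_mul]

end ConstantFields

/-! ### Isometry and vanishing torsion from the Jacobi identity on constant fields. -/

section Extraction

variable {U : Set (Fin 2 → ℝ)} {g : (Fin 2 → ℝ) → Matrix (Fin 2) (Fin 2) ℝ}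
    {Γ : (Fin 2 → ℝ) → Fin 2 → Fin 2 → Fin 2 → ℝ} {f : (Fin 2 → ℝ) → Fin 2 → ℝ} {ε : ℝ}
    {u₀ : Fin 2 → ℝ}

theorem mixedDefect_const_singleTest (α β γ : ℝ → ℝ) (i j l : Fin 2) (x : ℝ) :
    mixedDefect g Γ f (fun _ => u₀) (singleTest α i) (singleTest β j) (singleTest γ l) x =
      dxInv (fun y => f u₀ l * γ y) x * (α x * deriv β x * lieMetric g f u₀ i j) +
      f u₀ l * γ x * (α x * β x *
        ∑ k, (Γ u₀ i j k * f u₀ k - g u₀ i k * partialDeriv (fun v => f v j) k u₀)) := by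
  simp only [mixedDefect, contract_const_singleTest, deriv_const, mul_zero, zero_mul,
    Finset.sum_const_zero, add_zero, deriv_singleTest]
  rw [sum_sum_singleTest, sum_sum_singleTest fun i j =>
    ∑ k, (Γ u₀ i j k * f u₀ k - g u₀ i k * partialDeriv (fun v => f v j) k u₀)]

/-- The Jacobi identity on constant fields forces `f` to be an isometry where it does not vanish. -/
theorem lieMetric_eq_zero_of_jacobiAt_const (hc : SmoothCoefficients U g Γ f)
    (hs : SkewRelations U g Γ) (hε : ε ≠ 0) (hu₀ : u₀ ∈ U) (hf : f u₀ ≠ 0)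
    (hJ : JacobiAt g Γ f ε fun _ => u₀) (i j : Fin 2) : lieMetric g f u₀ i j = 0 := by
  obtain ⟨k, hk⟩ := Function.ne_iff.1 hf
  have hu := (isFieldIn_const hu₀).isSmoothIn
  obtain ⟨-, β, -, hβ, -, hβ0, -, hβi, hβ'⟩ := exists_isTest_bump
  -- The translate is supported in [4, 6], away from the support [-1, 1] of β, so all terms that are
  -- local in the three covectors vanish.
  set γ : ℝ → ℝ := fun x => β (x - 5) with hγ_def
  have hγ : IsTest γ := ⟨hβ.smooth.comp (contDiff_id.sub contDiff_const),
    hβ.compact.comp_homeomorph (Homeomorph.subRight (5 : ℝ))⟩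
  have hγ0 : ∀ x, x < 4 → γ =ᶠ[𝓝 x] fun _ => 0 := by
    intro x hx
    have h : Tendsto (fun y : ℝ => y - 5) (𝓝 x) (𝓝 (x - 5)) :=
      (continuous_id.sub continuous_const).tendsto x
    exact h.eventually (hβ0 (x - 5) (by rw [lt_abs]; right; linarith))
  have hγi : ∫ x, γ x = ∫ x, β x := integral_sub_right_eq_self β 5
  have hdisj : ∀ x, β =ᶠ[𝓝 x] (fun _ => 0) ∨ γ =ᶠ[𝓝 x] fun _ => 0 := fun x => by
    rcases lt_or_ge x 4 with h | h
    · exact Or.inr (hγ0 x h)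
    · exact Or.inl (hβ0 x (by rw [abs_of_nonneg] <;> linarith))
  have hdisj' : ∀ x, deriv β =ᶠ[𝓝 x] (fun _ => 0) ∨ γ =ᶠ[𝓝 x] fun _ => 0 := fun x => by
    refine (hdisj x).imp (fun h => ?_) id
    simpa using h.deriv
  have key := jacobiTerm_cyclic_sum (ε := ε) hc hu (hβ.deriv.singleTest i) (hβ.singleTest j)
    (hγ.singleTest k)
  have l1 : ∀ x, localTerm g Γ (fun _ => u₀) (singleTest (deriv β) i) (singleTest β j)
      (singleTest γ k) x = 0 := fun x =>
    localTerm_const_singleTest_eq_zero hγ _ _ _ ((hdisj x).elim (fun h => .inr (.inl h))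
      fun h => .inr (.inr h))
  have l2 : ∀ x, localTerm g Γ (fun _ => u₀) (singleTest β j) (singleTest γ k)
      (singleTest (deriv β) i) x = 0 := fun x =>
    localTerm_const_singleTest_eq_zero hβ.deriv _ _ _ ((hdisj x).elim (fun h => .inl h)
      fun h => .inr (.inl h))
  have l3 : ∀ x, localTerm g Γ (fun _ => u₀) (singleTest γ k) (singleTest (deriv β) i)
      (singleTest β j) x = 0 := fun x =>
    localTerm_const_singleTest_eq_zero hβ _ _ _ ((hdisj x).elim (fun h => .inr (.inr h))
      fun h => .inl h)
  -- To the left of the support of γ the nonlocal factor is the nonzero constant −½ fᵏ∫β. The choice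
  -- φ = β'eᵢ turns φψ' into β'², whose integral is positive, whereas ββ' would integrate to zero.
  have m1 : ∀ x, mixedDefect g Γ f (fun _ => u₀) (singleTest (deriv β) i) (singleTest β j)
      (singleTest γ k) x = (-(1 / 2) * (f u₀ k * ∫ y, β y) * lieMetric g f u₀ i j) *
        (deriv β x * deriv β x) := by
    intro x
    rw [mixedDefect_const_singleTest]
    rcases lt_or_ge x 4 with hx | hx
    · rw [dxInv_eq_of_forall_le fun y hy => by
        rw [(hγ0 y (lt_of_le_of_lt hy hx)).eq_of_nhds, mul_zero],
        integral_const_mul, hγi, (hγ0 x hx).eq_of_nhds]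
      ring
    · have h := hβ0 x (by rw [abs_of_nonneg] <;> linarith)
      simp [h.eq_of_nhds, h.deriv_eq]
  have m2 : ∀ x, mixedDefect g Γ f (fun _ => u₀) (singleTest β j) (singleTest γ k)
      (singleTest (deriv β) i) x = 0 := fun x => by
    rw [mixedDefect_const_singleTest]
    rcases hdisj x with h | h
    · simp [h.eq_of_nhds]
    · simp [h.eq_of_nhds, h.deriv_eq]
  have m3 : ∀ x, mixedDefect g Γ f (fun _ => u₀) (singleTest γ k) (singleTest (deriv β) i)
      (singleTest β j) x = 0 := fun x => by
    rw [mixedDefect_const_singleTest]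
    rcases hdisj' x with h | h
    · simp [h.eq_of_nhds, h.deriv_eq]
    · simp [h.eq_of_nhds]
  rw [hJ _ _ _ (hβ.deriv.singleTest i) (hβ.singleTest j) (hγ.singleTest k),
    integral_mixedTerm hc hu hs (hβ.deriv.singleTest i) (hβ.singleTest j) (hγ.singleTest k),
    integral_mixedTerm hc hu hs (hβ.singleTest j) (hγ.singleTest k) (hβ.deriv.singleTest i),
    integral_mixedTerm hc hu hs (hγ.singleTest k) (hβ.deriv.singleTest i) (hβ.singleTest j)] at key
  simp only [l1, l2, l3, m1, m2, m3, integral_zero, integral_const_mul, add_zero, zero_add] at key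
  have hk : f u₀ k ≠ 0 := hk
  simpa [hε, hk, hβi.ne', hβ'.ne'] using key.symm

theorem continuousOn_lieMetric (hc : SmoothCoefficients U g Γ f) (i j : Fin 2) :
    ContinuousOn (fun u => lieMetric g f u i j) U :=
  continuousOn_finsetSum _ fun k _ =>
    (((hc.vector k).continuousOn.mul ((hc.metric i j).partialDeriv hc.isOpen k).continuousOn).sub
      ((hc.metric k j).continuousOn.mul ((hc.vector i).partialDeriv hc.isOpen k).continuousOn)).sub
      ((hc.metric i k).continuousOn.mul ((hc.vector j).partialDeriv hc.isOpen k).continuousOn)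

/-- If `f` is an isometry where it does not vanish then it is an isometry. -/
theorem lieMetric_eq_zero_of_ne_zero (hc : SmoothCoefficients U g Γ f)
    (h : ∀ u ∈ U, f u ≠ 0 → ∀ i j, lieMetric g f u i j = 0) :
    ∀ u ∈ U, ∀ i j, lieMetric g f u i j = 0 := by
  intro u hu i j
  -- Either u is a limit of points where f ≠ 0, and continuity applies, or f vanishes near u
  -- together with its derivatives.
  by_cases hfreq : ∃ᶠ v in 𝓝 u, f v ≠ 0
  · have hev : ∃ᶠ v in 𝓝 u, lieMetric g f v i j ∈ ({0} : Set ℝ) :=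
      (hfreq.and_eventually (hc.isOpen.eventually_mem hu)).mono fun v hv => h v hv.2 hv.1 i j
    exact isClosed_singleton.mem_of_frequently_of_tendsto hev
      ((continuousOn_lieMetric hc i j).continuousAt (hc.isOpen.mem_nhds hu))
  · rw [not_frequently] at hfreq
    have hf : ∀ k, (fun v => f v k) =ᶠ[𝓝 u] fun _ => 0 := fun k =>
      hfreq.mono fun v hv => congrFun (not_not.1 hv) k
    have hd : ∀ k l, partialDeriv (fun v => f v k) l u = 0 := fun k l => by
      simp [partialDeriv, (hf k).fderiv_eq]
    simp [lieMetric, hd, fun k => (hf k).eq_of_nhds]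

/-- The Jacobi identity on constant fields forces the symbol `Γ` to be torsion free. -/
theorem torsionFree_of_jacobiAt_const (hc : SmoothCoefficients U g Γ f)
    (hs : SkewRelations U g Γ) (hL : ∀ v ∈ U, ∀ i j, lieMetric g f v i j = 0) (hu₀ : u₀ ∈ U)
    (hJ : JacobiAt g Γ f ε fun _ => u₀) (i j l : Fin 2) :
    ∑ k, Γ u₀ j i k * g u₀ k l = ∑ k, Γ u₀ l i k * g u₀ k j := by
  have hu := (isFieldIn_const hu₀).isSmoothIn
  obtain ⟨α, β, hα, hβ, hα1, hβ0, -, -, hβ'⟩ := exists_isTest_bump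
  -- Here uₓ = 0, so the condition on `lieSymbol` is void: torsion-freeness is available before Γ is
  -- known to be preserved.
  have key := jacobiTerm_cyclic_sum_eq_local (ε := ε) hc hu hs hL (by simp)
    (hα.singleTest i) (hβ.singleTest j) (hβ.singleTest l)
  have hcases : ∀ x, α =ᶠ[𝓝 x] (fun _ => 1) ∨ β =ᶠ[𝓝 x] fun _ => 0 := fun x => by
    rcases lt_or_ge |x| 2 with h | h
    · exact Or.inl (hα1 x h)
    · exact Or.inr (hβ0 x (by linarith))
  have l1 : ∀ x, localTerm g Γ (fun _ => u₀) (singleTest α i) (singleTest β j)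
      (singleTest β l) x =
      (∑ m, partialDeriv (fun v => g v i j) m u₀ * g u₀ m l) * (deriv β x * deriv β x) +
        (∑ k, Γ u₀ i j k * g u₀ k l) * (β x * deriv (deriv β) x) := fun x => by
    rw [localTerm_const_singleTest hβ]
    rcases hcases x with h | h
    · rw [h.eq_of_nhds]; ring
    · simp [h.eq_of_nhds, h.deriv_eq]
  -- In this slot only α' and α'' occur, and they vanish near the support of β.
  have l2 : ∀ x, localTerm g Γ (fun _ => u₀) (singleTest β j) (singleTest β l)
      (singleTest α i) x = 0 := fun x => by
    rw [localTerm_const_singleTest hα]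
    rcases hcases x with h | h
    · simp [h.deriv_eq, h.deriv.deriv_eq]
    · simp [h.eq_of_nhds]
  have l3 : ∀ x, localTerm g Γ (fun _ => u₀) (singleTest β l) (singleTest α i)
      (singleTest β j) x = (∑ k, Γ u₀ l i k * g u₀ k j) * (β x * deriv (deriv β) x) := fun x => by
    rw [localTerm_const_singleTest hβ]
    rcases hcases x with h | h
    · rw [h.eq_of_nhds, h.deriv_eq]; simp; ring
    · simp [h.eq_of_nhds]
  rw [hJ _ _ _ (hα.singleTest i) (hβ.singleTest j) (hβ.singleTest l)] at key
  simp only [l1, l2, l3, integral_zero, add_zero] at key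
  rw [integral_add ((hβ.deriv.mul_smooth hβ.deriv.smooth).integrable.const_mul _)
    ((hβ.mul_smooth hβ.deriv.deriv.smooth).integrable.const_mul _), integral_const_mul,
    integral_const_mul, integral_const_mul, integral_mul_deriv_deriv hβ] at key
  -- Since ∫ββ'' = −∫β'², the Γⁱʲ part of ∂g cancels against the second summand of `l1`; the
  -- difference of the two sides of the claim remains, times ∫β'².
  have hsum : ∑ m, partialDeriv (fun v => g v i j) m u₀ * g u₀ m l =
      (∑ k, Γ u₀ i j k * g u₀ k l) + ∑ k, Γ u₀ j i k * g u₀ k l := by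
    simp only [hs.compat _ hu₀, add_mul, Finset.sum_add_distrib]
  rw [hsum] at key
  refine mul_right_cancel₀ hβ'.ne' ?_
  linear_combination -key

end Extraction

/-! ### Isometries preserve the Levi-Civita symbol. -/

section LieSymbol

variable {n : ℕ} {U : Set (Fin n → ℝ)}

theorem hasDerivAt_line (hU : IsOpen U) {h : (Fin n → ℝ) → ℝ} (hh : ContDiffOn ℝ ∞ h U)
    {u : Fin n → ℝ} (hu : u ∈ U) (m : Fin n) :
    HasDerivAt (fun t : ℝ => h (u + t • Pi.single m 1)) (partialDeriv h m u) 0 := by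
  have h1 : HasFDerivAt h (fderiv ℝ h u) u :=
    ((hh.contDiffAt (hU.mem_nhds hu)).differentiableAt (by norm_num)).hasFDerivAt
  have h2 : HasDerivAt (fun t : ℝ => u + t • (Pi.single m 1 : Fin n → ℝ)) (Pi.single m 1) 0 := by
    simpa using ((hasDerivAt_id (0 : ℝ)).smul_const (Pi.single m 1 : Fin n → ℝ)).const_add u
  exact h1.comp_hasDerivAt_of_eq (0 : ℝ) h2 (by simp)

theorem eq_zero_of_hasDerivAt_line (hU : IsOpen U) {h : (Fin n → ℝ) → ℝ}
    (hh : ∀ v ∈ U, h v = 0) {u : Fin n → ℝ} (hu : u ∈ U) (m : Fin n) {d : ℝ}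
    (hd : HasDerivAt (fun t : ℝ => h (u + t • Pi.single m 1)) d 0) : d = 0 := by
  refine hd.unique ((hasDerivAt_const (0 : ℝ) (0 : ℝ)).congr_of_eventuallyEq ?_)
  have hcont : Continuous fun t : ℝ => u + t • (Pi.single m 1 : Fin n → ℝ) := by fun_prop
  have : ∀ᶠ t : ℝ in 𝓝 0, u + t • (Pi.single m 1 : Fin n → ℝ) ∈ U :=
    hcont.continuousAt.eventually (by simpa using hU.eventually_mem hu)
  exact this.mono fun t ht => hh _ ht

theorem partialDeriv_comm (hU : IsOpen U) {h : (Fin n → ℝ) → ℝ} (hh : ContDiffOn ℝ ∞ h U)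
    {u : Fin n → ℝ} (hu : u ∈ U) (k m : Fin n) :
    partialDeriv (partialDeriv h k) m u = partialDeriv (partialDeriv h m) k u := by
  have hsymm : IsSymmSndFDerivAt ℝ h u := (hh.contDiffAt (hU.mem_nhds hu)).isSymmSndFDerivAt
    (by rw [minSmoothness_of_isRCLikeNormedField]; exact WithTop.coe_le_coe.2 (le_top : (2 : ℕ∞) ≤ ⊤))
  have hfd : DifferentiableAt ℝ (fderiv ℝ h) u :=
    ((hh.fderiv_of_isOpen (m := ∞) hU (by norm_num)).contDiffAt
      (hU.mem_nhds hu)).differentiableAt (by norm_num)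
  have hd : ∀ k m : Fin n, partialDeriv (partialDeriv h k) m u =
      fderiv ℝ (fderiv ℝ h) u (Pi.single m 1) (Pi.single k 1) := fun k m => by
    have := hfd.hasFDerivAt.clm_apply (hasFDerivAt_const (Pi.single k 1 : Fin n → ℝ) u)
    change fderiv ℝ (fun v => fderiv ℝ h v (Pi.single k 1)) u _ = _
    rw [this.fderiv]
    simp
  rw [hd, hd, hsymm]

/-- This is uniqueness of the Levi-Civita symbol, infinitesimally: S is the Lie derivative of Γ.
Deriving metric compatibility along f makes S skew in i, j; deriving torsion-freeness gives two
linear equations for S⁰¹₀, S⁰¹₁ whose matrix is g, up to signs. In the letters, the last index of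
df, ddf and dG is the last differentiation. -/
theorem lieSymbol_algebra (f : Fin 2 → ℝ) (gm df : Fin 2 → Fin 2 → ℝ)
    (G ddf : Fin 2 → Fin 2 → Fin 2 → ℝ) (dG : Fin 2 → Fin 2 → Fin 2 → Fin 2 → ℝ)
    (S : Fin 2 → Fin 2 → Fin 2 → ℝ)
    (hSdef : ∀ i j m, S i j m = ∑ l, (f l * dG i j m l + G i j l * df l m -
          G l j m * df i l - G i l m * df j l - gm i l * ddf j l m))
    (hsymm : ∀ i j, gm i j = gm j i) (hddf : ∀ j l m, ddf j l m = ddf j m l)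
    (hdet : gm 0 0 * gm 1 1 - gm 0 1 * gm 1 0 ≠ 0)
    (hL : ∀ i j, ∑ k, (f k * (G i j k + G j i k) - gm k j * df i k - gm i k * df j k) = 0)
    (hdL : ∀ i j m, ∑ k, ((df k m * (G i j k + G j i k) + f k * (dG i j m k + dG j i m k)) -
      ((G k j m + G j k m) * df i k + gm k j * ddf i k m) -
      ((G i k m + G k i m) * df j k + gm i k * ddf j k m)) = 0)
    (hT : ∀ i j l, ∑ k, (G j i k * gm k l - G l i k * gm k j) = 0)
    (hdT : ∀ i j l m, ∑ k, ((dG j i k m * gm k l + G j i k * (G k l m + G l k m)) -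
      (dG l i k m * gm k j + G l i k * (G k j m + G j k m))) = 0) (i j m : Fin 2) :
    S i j m = 0 := by
  have hskew : ∀ i j m, S i j m + S j i m = 0 := by
    intro i j m
    have h := hdL i j m
    simp only [hSdef, Fin.sum_univ_two] at h ⊢
    linear_combination h + ddf i 0 m * hsymm 0 j + ddf i 1 m * hsymm 1 j
  -- The Lie derivative of the torsion identity: its derivative in the direction f, corrected by
  -- multiples of the isometry equations and of the identity itself.
  have hE : ∀ k, (gm 0 0 * S 1 k 0 + gm 0 1 * S 1 k 1) - (gm 1 0 * S 0 k 0 + gm 1 1 * S 0 k 1) = 0 := by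
    intro k
    have t0 := hdT k 1 0 0
    have t1 := hdT k 1 0 1
    have a00 := hL 0 0
    have a01 := hL 0 1
    have a10 := hL 1 0
    have a11 := hL 1 1
    have b := hT k 1 0
    have b0 := hT 0 1 0
    have b1 := hT 1 1 0
    simp only [hSdef, Fin.sum_univ_two, hsymm 1 0, hddf _ 1 0] at t0 t1 a00 a01 a10 a11 b b0 b1 ⊢
    linear_combination f 0 * t0 + f 1 * t1 - G 1 k 0 * a00 - G 1 k 1 * a01 + G 0 k 0 * a10 +
      G 0 k 1 * a11 - (df 0 0 + df 1 1) * b - df k 0 * b0 - df k 1 * b1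
  have hsol : ∀ a b : ℝ, gm 0 0 * a + gm 0 1 * b = 0 → gm 1 0 * a + gm 1 1 * b = 0 →
      a = 0 ∧ b = 0 := fun a b h1 h2 =>
    ⟨(mul_eq_zero.1 (by linear_combination gm 1 1 * h1 - gm 0 1 * h2 :
        (gm 0 0 * gm 1 1 - gm 0 1 * gm 1 0) * a = 0)).resolve_left hdet,
      (mul_eq_zero.1 (by linear_combination gm 0 0 * h2 - gm 1 0 * h1 :
        (gm 0 0 * gm 1 1 - gm 0 1 * gm 1 0) * b = 0)).resolve_left hdet⟩
  have hdiag : ∀ i m, S i i m = 0 := fun i m => by linarith [hskew i i m]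
  have h0 := hE 0
  have h1 := hE 1
  simp only [hdiag, mul_zero, add_zero, sub_zero, zero_sub, neg_eq_zero] at h0 h1
  have h2 : ∀ m, S 1 0 m = -S 0 1 m := fun m => by linarith [hskew 0 1 m]
  -- By skewness the equations for k = 0 and k = 1 are the two rows of g applied to (S⁰¹₀, S⁰¹₁).
  obtain ⟨s0, s1⟩ := hsol (S 0 1 0) (S 0 1 1) (by rw [h2, h2] at h0; linarith) h1
  have hs : ∀ m, S 0 1 m = 0 := fun m => by fin_cases m <;> assumption
  fin_cases i <;> fin_cases j <;> simp [hdiag, h2, hs]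

end LieSymbol

/-! ### Linearity along the pencil and removal of the tail. -/

section Pencil

variable {U : Set (Fin 2 → ℝ)} {g h : (Fin 2 → ℝ) → Matrix (Fin 2) (Fin 2) ℝ}
    {Γ Δ : (Fin 2 → ℝ) → Fin 2 → Fin 2 → Fin 2 → ℝ} {f : (Fin 2 → ℝ) → Fin 2 → ℝ} {ε : ℝ}

/-- An isometry of a nondegenerate metric preserves its Levi-Civita symbol. -/
theorem lieSymbol_eq_zero (hc : SmoothCoefficients U g Γ f) (hs : SkewRelations U g Γ)
    (hL : ∀ u ∈ U, ∀ i j, lieMetric g f u i j = 0) (hdet : ∀ u ∈ U, (g u).det ≠ 0)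
    (hT : ∀ u ∈ U, ∀ i j l, ∑ k, Γ u j i k * g u k l = ∑ k, Γ u l i k * g u k j) :
    ∀ u ∈ U, ∀ i j m, lieSymbol g Γ f u i j m = 0 := by
  intro u hu
  have hT' : ∀ v ∈ U, ∀ i j l, ∑ k, (Γ v j i k * g v k l - Γ v l i k * g v k j) = 0 :=
    fun v hv i j l => by rw [Finset.sum_sub_distrib, hT v hv, sub_self]
  have lf : ∀ k m, HasDerivAt (fun t : ℝ => f (u + t • Pi.single m 1) k) _ 0 := fun k m =>
    hasDerivAt_line hc.isOpen (hc.vector k) hu m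
  have lg : ∀ i j m, HasDerivAt (fun t : ℝ => g (u + t • Pi.single m 1) i j) _ 0 := fun i j m =>
    hasDerivAt_line hc.isOpen (hc.metric i j) hu m
  have lΓ : ∀ i j k m, HasDerivAt (fun t : ℝ => Γ (u + t • Pi.single m 1) i j k) _ 0 :=
    fun i j k m => hasDerivAt_line hc.isOpen (hc.symbol i j k) hu m
  have ldf : ∀ k l m, HasDerivAt
      (fun t : ℝ => partialDeriv (fun v => f v k) l (u + t • Pi.single m 1)) _ 0 := fun k l m =>
    hasDerivAt_line hc.isOpen ((hc.vector k).partialDeriv hc.isOpen l) hu m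
  have ldg : ∀ i j l m, HasDerivAt
      (fun t : ℝ => partialDeriv (fun v => g v i j) l (u + t • Pi.single m 1)) _ 0 :=
    fun i j l m => hasDerivAt_line hc.isOpen ((hc.metric i j).partialDeriv hc.isOpen l) hu m
  -- Second partials of g are exchanged before compatibility is used, so that the derivatives of Γ
  -- appear as fᵏ∂ₖΓₘ, as in the Lie derivative.
  have hddg : ∀ i j k m, partialDeriv (partialDeriv (fun v => g v i j) k) m u =
      partialDeriv (fun v => Γ v i j m) k u + partialDeriv (fun v => Γ v j i m) k u := by
    intro i j k m
    rw [partialDeriv_comm hc.isOpen (hc.metric i j) hu]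
    exact sub_eq_zero.1 (eq_zero_of_hasDerivAt_line hc.isOpen
      (h := fun v => partialDeriv (fun v => g v i j) m v - (Γ v i j m + Γ v j i m))
      (fun v hv => by rw [hs.compat v hv]; ring) hu k
      ((ldg i j m k).sub ((lΓ i j m k).add (lΓ j i m k))))
  have hdet' := hdet u hu
  rw [Matrix.det_fin_two] at hdet'
  refine lieSymbol_algebra (f u) (g u) (fun i k => partialDeriv (fun v => f v i) k u) (Γ u)
    (fun j l m => partialDeriv (partialDeriv (fun v => f v j) l) m u)
    (fun i j k l => partialDeriv (fun v => Γ v i j k) l u) (lieSymbol g Γ f u)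
    (fun i j m => rfl) (hs.symm u hu)
    (fun j l m => partialDeriv_comm hc.isOpen (hc.vector j) hu l m) hdet' ?_ ?_ (hT' u hu) ?_
  · intro i j
    simp only [← hs.compat u hu]
    exact hL u hu i j
  · intro i j m
    have := eq_zero_of_hasDerivAt_line hc.isOpen (fun v hv => hL v hv i j) hu m
      (HasDerivAt.fun_sum (u := Finset.univ) fun k _ =>
        (((lf k m).mul (ldg i j k m)).sub ((lg k j m).mul (ldf i k m))).sub
          ((lg i k m).mul (ldf j k m)))
    simp only [zero_smul, add_zero, hddg, hs.compat u hu] at this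
    exact this
  · intro i j l m
    have := eq_zero_of_hasDerivAt_line hc.isOpen (fun v hv => hT' v hv i j l) hu m
      (HasDerivAt.fun_sum (u := Finset.univ) fun k _ =>
        ((lΓ j i k m).mul (lg k l m)).sub ((lΓ l i k m).mul (lg k j m)))
    simp only [zero_smul, add_zero, hs.compat u hu] at this
    exact this

/-- If `f` preserves the local part, then the Hamiltonian property of `weaklyNonlocal` does not
depend on the coefficient of the nonlocal tail. -/
theorem isHamiltonian_weaklyNonlocal_congr (hc : SmoothCoefficients U g Γ f)
    (hs : SkewRelations U g Γ) (hL : ∀ u ∈ U, ∀ i j, lieMetric g f u i j = 0)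
    (hS : ∀ u ∈ U, ∀ i j m, lieSymbol g Γ f u i j m = 0) (ε ε' : ℝ) :
    IsHamiltonian U (weaklyNonlocal g Γ f ε) ↔ IsHamiltonian U (weaklyNonlocal g Γ f ε') := by
  rw [isHamiltonian_weaklyNonlocal_iff hc, isHamiltonian_weaklyNonlocal_iff hc,
    isSkewOn_weaklyNonlocal_iff hc, isSkewOn_weaklyNonlocal_iff hc]
  refine and_congr_right' (forall₂_congr fun u hu => forall₃_congr fun φ ψ χ =>
    forall₃_congr fun hφ hψ hχ => ?_)
  have hu := hu.isSmoothIn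
  have hS' : ∀ x i j m, deriv (fun y => u y m) x * lieSymbol g Γ f (u x) i j m = 0 :=
    fun x i j m => by rw [hS _ (hu.mem x), mul_zero]
  rw [jacobiTerm_cyclic_sum_eq_local hc hu hs hL hS' hφ hψ hχ,
    jacobiTerm_cyclic_sum_eq_local hc hu hs hL hS' hφ hψ hχ]

theorem partialDeriv_add_mul {n : ℕ} {a b : (Fin n → ℝ) → ℝ} {u : Fin n → ℝ}
    (ha : DifferentiableAt ℝ a u) (hb : DifferentiableAt ℝ b u) (c : ℝ) (k : Fin n) :
    partialDeriv (fun v => a v + c * b v) k u = partialDeriv a k u + c * partialDeriv b k u := by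
  have := ha.hasFDerivAt.add (hb.hasFDerivAt.const_mul c)
  rw [partialDeriv, HasFDerivAt.fderiv (f := fun v => a v + c * b v) this]
  simp [partialDeriv]

theorem differentiableAt_of_contDiffOn_isOpen (hU : IsOpen U) {a : (Fin 2 → ℝ) → ℝ}
    (ha : ContDiffOn ℝ ∞ a U) {u : Fin 2 → ℝ} (hu : u ∈ U) : DifferentiableAt ℝ a u :=
  (ha.contDiffAt (hU.mem_nhds hu)).differentiableAt (by norm_num)

theorem SmoothCoefficients.add_smul (hg : SmoothCoefficients U g Γ f)
    (hh : SmoothCoefficients U h Δ f) (c : ℝ) :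
    SmoothCoefficients U (fun u => g u + c • h u) (fun u i j k => Γ u i j k + c * Δ u i j k) f where
  isOpen := hg.isOpen
  metric i j := (hg.metric i j).add (contDiffOn_const.mul (hh.metric i j))
  symbol i j k := (hg.symbol i j k).add (contDiffOn_const.mul (hh.symbol i j k))
  vector := hg.vector

theorem SkewRelations.add_smul (hcg : SmoothCoefficients U g Γ f) (hch : SmoothCoefficients U h Δ f)
    (hg : SkewRelations U g Γ) (hh : SkewRelations U h Δ) (c : ℝ) :
    SkewRelations U (fun u => g u + c • h u) (fun u i j k => Γ u i j k + c * Δ u i j k) where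
  symm u hu i j := by
    simp only [Matrix.add_apply, Matrix.smul_apply, smul_eq_mul, hg.symm u hu i j, hh.symm u hu i j]
  compat u hu i j k := by
    simp only [Matrix.add_apply, Matrix.smul_apply, smul_eq_mul]
    rw [partialDeriv_add_mul (differentiableAt_of_contDiffOn_isOpen hcg.isOpen (hcg.metric i j) hu)
      (differentiableAt_of_contDiffOn_isOpen hcg.isOpen (hch.metric i j) hu), hg.compat u hu,
      hh.compat u hu]
    ring

theorem lieMetric_add_smul (hcg : SmoothCoefficients U g Γ f) (hch : SmoothCoefficients U h Δ f)
    (c : ℝ) {u : Fin 2 → ℝ} (hu : u ∈ U) (i j : Fin 2) :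
    lieMetric (fun u => g u + c • h u) f u i j = lieMetric g f u i j + c * lieMetric h f u i j := by
  simp only [lieMetric, Matrix.add_apply, Matrix.smul_apply, smul_eq_mul, Finset.mul_sum,
    ← Finset.sum_add_distrib]
  refine Finset.sum_congr rfl fun k _ => ?_
  rw [partialDeriv_add_mul (differentiableAt_of_contDiffOn_isOpen hcg.isOpen (hcg.metric i j) hu)
    (differentiableAt_of_contDiffOn_isOpen hcg.isOpen (hch.metric i j) hu)]
  ring

/-- Linearity covers degenerate members of the pencil, for which the Levi-Civita argument fails. -/
theorem lieSymbol_add_smul (hcg : SmoothCoefficients U g Γ f) (hch : SmoothCoefficients U h Δ f)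
    (c : ℝ) {u : Fin 2 → ℝ} (hu : u ∈ U) (i j m : Fin 2) :
    lieSymbol (fun u => g u + c • h u) (fun u i j k => Γ u i j k + c * Δ u i j k) f u i j m =
      lieSymbol g Γ f u i j m + c * lieSymbol h Δ f u i j m := by
  simp only [lieSymbol, Matrix.add_apply, Matrix.smul_apply, smul_eq_mul, Finset.mul_sum,
    ← Finset.sum_add_distrib]
  refine Finset.sum_congr rfl fun k _ => ?_
  rw [partialDeriv_add_mul (differentiableAt_of_contDiffOn_isOpen hcg.isOpen (hcg.symbol i j m) hu)
    (differentiableAt_of_contDiffOn_isOpen hcg.isOpen (hch.symbol i j m) hu)]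
  ring

/-- The class is closed under pencils because the tail carries a real coefficient; a negative one
could not be absorbed by rescaling f. -/
theorem weaklyNonlocal_add_smul (c ε ε' : ℝ) :
    weaklyNonlocal g Γ f ε + c • weaklyNonlocal h Δ f ε' =
      weaklyNonlocal (fun u => g u + c • h u) (fun u i j k => Γ u i j k + c * Δ u i j k) f
        (ε + c * ε') := by
  funext u ψ x i
  have e : hydroOperator (fun u => g u + c • h u) (fun u i j k => Γ u i j k + c * Δ u i j k) u ψ x i =
      hydroOperator g Γ u ψ x i + c * hydroOperator h Δ u ψ x i := by
    simp only [hydroOperator, Matrix.add_apply, Matrix.smul_apply, smul_eq_mul, Finset.mul_sum,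
      ← Finset.sum_add_distrib]
    refine Finset.sum_congr rfl fun j _ => ?_
    rw [mul_add c, add_add_add_comm, Finset.mul_sum, ← Finset.sum_add_distrib]
    exact congrArg₂ _ (by ring) (Finset.sum_congr rfl fun k _ => by ring)
  simp only [weaklyNonlocal, Pi.add_apply, Pi.smul_apply, smul_eq_mul, e]
  ring

/-- If `f` is an isometry of the metrics of two skew-symmetric local operators, both nondegenerate
and with torsion-free symbols, then adding nonlocal tails along `f` does not affect the property of
being a bi-Hamiltonian pair. -/
theorem isBiHamiltonianPair_congr (hcg : SmoothCoefficients U g Γ f)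
    (hch : SmoothCoefficients U h Δ f) (hg : SkewRelations U g Γ) (hh : SkewRelations U h Δ)
    (hLg : ∀ u ∈ U, ∀ i j, lieMetric g f u i j = 0) (hLh : ∀ u ∈ U, ∀ i j, lieMetric h f u i j = 0)
    (hdg : ∀ u ∈ U, (g u).det ≠ 0) (hdh : ∀ u ∈ U, (h u).det ≠ 0)
    (hTg : ∀ u ∈ U, ∀ i j l, ∑ k, Γ u j i k * g u k l = ∑ k, Γ u l i k * g u k j)
    (hTh : ∀ u ∈ U, ∀ i j l, ∑ k, Δ u j i k * h u k l = ∑ k, Δ u l i k * h u k j)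
    (ε ε' : ℝ) :
    IsBiHamiltonianPair U (weaklyNonlocal g Γ f 0) (weaklyNonlocal h Δ f ε) ↔
      IsBiHamiltonianPair U (weaklyNonlocal g Γ f 0) (weaklyNonlocal h Δ f ε') := by
  -- Nondegeneracy is used for the two generators only; every other member inherits the conclusion
  -- by linearity.
  have hSg := lieSymbol_eq_zero hcg hg hLg hdg hTg
  have hSh := lieSymbol_eq_zero hch hh hLh hdh hTh
  refine and_congr_right' (and_congr (isHamiltonian_weaklyNonlocal_congr hch hh hLh hSh _ _)
    (forall_congr' fun c => ?_))
  rw [weaklyNonlocal_add_smul, weaklyNonlocal_add_smul]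
  refine isHamiltonian_weaklyNonlocal_congr (hcg.add_smul hch c) (hg.add_smul hcg hch hh c)
    (fun u hu i j => ?_) (fun u hu i j m => ?_) _ _
  · rw [lieMetric_add_smul hcg hch c hu, hLg u hu, hLh u hu, mul_zero, add_zero]
  · rw [lieSymbol_add_smul hcg hch c hu, hSg u hu, hSh u hu, mul_zero, add_zero]

/-- The nonlocal tail of a Hamiltonian operator is an isometry of its metric. -/
theorem IsHamiltonian.lieMetric_eq_zero (hc : SmoothCoefficients U g Γ f) (hε : ε ≠ 0)
    (h : IsHamiltonian U (weaklyNonlocal g Γ f ε)) :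
    ∀ u ∈ U, ∀ i j, lieMetric g f u i j = 0 := by
  obtain ⟨hskew, hJ⟩ := (isHamiltonian_weaklyNonlocal_iff hc).1 h
  exact lieMetric_eq_zero_of_ne_zero hc fun u hu hf =>
    lieMetric_eq_zero_of_jacobiAt_const hc (hskew.skewRelations hc) hε hu hf
      (hJ _ (isFieldIn_const hu))

theorem IsHamiltonian.torsionFree (hc : SmoothCoefficients U g Γ f)
    (h : IsHamiltonian U (weaklyNonlocal g Γ f ε)) (hL : ∀ u ∈ U, ∀ i j, lieMetric g f u i j = 0) :
    ∀ u ∈ U, ∀ i j l, ∑ k, Γ u j i k * g u k l = ∑ k, Γ u l i k * g u k j := by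
  obtain ⟨hskew, hJ⟩ := (isHamiltonian_weaklyNonlocal_iff hc).1 h
  exact fun u hu => torsionFree_of_jacobiAt_const hc (hskew.skewRelations hc) hL hu
    (hJ _ (isFieldIn_const hu))

theorem IsHamiltonian.skewRelations (hc : SmoothCoefficients U g Γ f)
    (h : IsHamiltonian U (weaklyNonlocal g Γ f ε)) : SkewRelations U g Γ :=
  ((isHamiltonian_weaklyNonlocal_iff hc).1 h).1.skewRelations hc

end Pencil

theorem theorem1 (U : Set (Fin 2 → ℝ)) (hU : IsOpen U)
    (η : Matrix (Fin 2) (Fin 2) ℝ) (hη_symm : η.IsSymm) (hη : η.det ≠ 0)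
    (g : (Fin 2 → ℝ) → Matrix (Fin 2) (Fin 2) ℝ)
    (Γ : (Fin 2 → ℝ) → Fin 2 → Fin 2 → Fin 2 → ℝ)
    (f : (Fin 2 → ℝ) → Fin 2 → ℝ)
    (hg_smooth : ∀ i j, ContDiffOn ℝ ∞ (fun u => g u i j) U)
    (hΓ_smooth : ∀ i j k, ContDiffOn ℝ ∞ (fun u => Γ u i j k) U)
    (hf_smooth : ∀ i, ContDiffOn ℝ ∞ (fun u => f u i) U)
    (hg : ∀ u ∈ U, (g u).det ≠ 0) :
    (IsBiHamiltonianPair U (hydroOperator (fun _ => η) 0) (hydroOperator g Γ + tailOperator f) ↔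
      IsBiHamiltonianPair U (hydroOperator (fun _ => η) 0) (hydroOperator g Γ) ∧
        (IsInfinitesimalIsometry U (fun _ => η) f ∧ IsInfinitesimalIsometry U g f)) ∧
    (IsInfinitesimalIsometry U (fun _ => η) f → IsInfinitesimalIsometry U g f →
      ∀ c : ℝ, IsInfinitesimalIsometry U (fun u => g u + c • η) f) := by
  have hcg : SmoothCoefficients U g Γ f := ⟨hU, hg_smooth, hΓ_smooth, hf_smooth⟩
  have hcη : SmoothCoefficients U (fun _ => η) 0 f :=
    ⟨hU, fun _ _ => contDiffOn_const, fun _ _ _ => contDiffOn_const, hf_smooth⟩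
  have hA : hydroOperator (fun _ => η) 0 = weaklyNonlocal (fun _ => η) 0 f 0 := by
    rw [weaklyNonlocal, zero_smul, add_zero]
  have hB₀ : hydroOperator g Γ = weaklyNonlocal g Γ f 0 := by
    rw [weaklyNonlocal, zero_smul, add_zero]
  have hB : hydroOperator g Γ + tailOperator f = weaklyNonlocal g Γ f 1 := by
    rw [weaklyNonlocal, one_smul]
  have hsη : SkewRelations U (fun _ => η) 0 :=
    ⟨fun _ _ i j => (hη_symm.apply i j).symm, fun u _ i j k => by simp [partialDeriv]⟩
  -- Skewness and torsion-freeness can be read off from either version of the second operator: ε = 1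
  -- serves one implication, ε = 0 the other.
  have hcongr : ∀ ε, IsHamiltonian U (weaklyNonlocal g Γ f ε) →
      (∀ u ∈ U, ∀ i j, lieMetric (fun _ => η) f u i j = 0) →
      (∀ u ∈ U, ∀ i j, lieMetric g f u i j = 0) →
      (IsBiHamiltonianPair U (weaklyNonlocal (fun _ => η) 0 f 0) (weaklyNonlocal g Γ f 1) ↔
        IsBiHamiltonianPair U (weaklyNonlocal (fun _ => η) 0 f 0) (weaklyNonlocal g Γ f 0)) :=
    fun ε h hLη hLg => isBiHamiltonianPair_congr hcη hcg hsη (h.skewRelations hcg) hLη hLg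
      (fun _ _ => hη) hg (by simp) (h.torsionFree hcg hLg) 1 0
  refine ⟨?_, fun hLη hLg c u hu i j => ?_⟩
  · rw [hB, hA, hB₀]
    constructor
    · intro h
      have hLg := h.2.1.lieMetric_eq_zero hcg one_ne_zero
      have hLη : ∀ u ∈ U, ∀ i j, lieMetric (fun _ => η) f u i j = 0 := by
        intro u hu i j
        -- A + B has metric η + g and tail coefficient 1. Extracting the isometry needs no
        -- nondegeneracy of η + g, and subtracting L_f g = 0 leaves L_f η = 0.
        have h1 := h.2.2 1
        rw [weaklyNonlocal_add_smul] at h1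
        have h2 := h1.lieMetric_eq_zero (hcη.add_smul hcg 1) (by norm_num) u hu i j
        rwa [lieMetric_add_smul hcη hcg 1 hu, hLg u hu, mul_zero, add_zero] at h2
      exact ⟨(hcongr 1 h.2.1 hLη hLg).1 h, hLη, hLg⟩
    · rintro ⟨h, hLη, hLg⟩
      exact (hcongr 0 h.2.1 hLη hLg).2 h
  · have h := lieMetric_add_smul hcg hcη c hu i j
    rw [show lieMetric g f u i j = 0 from hLg u hu i j,
      show lieMetric (fun _ => η) f u i j = 0 from hLη u hu i j, mul_zero, add_zero] at h
    exact h
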